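/- Let $k$ be an algebraically closed field of characteristic $p>0$, and let $(R,\mathfrak m)$ be an integral, complete, Noetherian local $k$-algebra of dimension at least $2$ that satisfies Serre's condition $S_2$. Put $X=\operatorname{Spec}R$, let $x\in X$ be the closed point and $U=X\setminus\{x\}$. For natural numbers $n,m$ let $\mathbf W_n$ be the group scheme of $p$-typical Witt vectors of length $n$, let $\mathbf L_{n,m}=\mathbf W_n[F^m]$ be the kernel of the $m$-th power of the Frobenius $F$ on $\mathbf W_n$, and let $$\overline{H^1_{\mathrm{fl}}(U,\mathbf L_{n,m})}=\operatorname{Coker}\bigl(H^1_{\mathrm{fl}}(X,\mathbf L_{n,m})\to H^1_{\mathrm{fl}}(U,\mathbf L_{n,m})\bigr)$$ be the group of equivalence classes of local $\mathbf L_{n,m}$-torsors over $X$ (cohomology for the fppf topology). Let $W_n\mathcal O_X$ be the Zariski sheaf of Witt vectors of length $n$ of $\mathcal O_X$, and let $H^2_{\mathfrak m}(X,W_n\mathcal O_X)$ be its second cohomology group with support in $x$. Let $\sigma$ be the Frobenius of $W(k)$ and let $\mathbb D=W(k)\{F,V\}$ be the Dieudonné ring, with relations $FV=VF=p$, $Fa=\sigma(a)F$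 and $aV=V\sigma(a)$ for $a\in W(k)$. It acts from the left on $\mathbf L_{n,m}$ and on $W_n\mathcal O_X$: $F$ and $V$ act as the Frobenius and the Verschiebung, and $a\in W(k)$ acts as multiplication by $\sigma^{-n}(a)$. By functoriality, $\overline{H^1_{\mathrm{fl}}(U,\mathbf L_{n,m})}$ and $H^2_{\mathfrak m}(X,W_n\mathcal O_X)$ are left $\mathbb D$-modules, and the kernel $H^2_{\mathfrak m}(X,W_n\mathcal O_X)[F^m]$ of $F^m$ is a $\mathbb D$-submodule. Then there is a canonical isomorphism of left $\mathbb D$-modules $$\overline{H^1_{\mathrm{fl}}(U,\mathbf L_{n,m})}\;\cong\;H^2_{\mathfrak m}(X,W_n\mathcal O_X)[F^m].$$ It is the unique one with the following property: for every $\xi\in H^1_{\mathrm{fl}}(U,\mathbf L_{n,m})$ there is a class $z\in H^1(U,W_n\mathcal O_U)$ (Zariski cohomology) whose image in $H^1_{\mathrm{fl}}(U,\mathbf W_n)$ is the image of $\xi$ under the inclusion $\mathbf L_{n,m}\subset\mathbf W_n$, and such that the isomorphism sends the class of $\xi$ to the image of $z$ under the connecting homomorphism $H^1(U,W_n\mathcal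 O_U)\to H^2_{\mathfrak m}(X,W_n\mathcal O_X)$ of local cohomology. -/

import Mathlib

open CategoryTheory Limits AlgebraicGeometry
universe u

noncomputable section

set_option linter.unusedSectionVars false

namespace LocalTorsor

/-! ### Witt vectors of finite length over algebras of characteristic `p` -/

section Witt

variable (p : ℕ) [Fact p.Prime] (k : Type u) [Field k] [CharP k p]

/-- The `p`-th power map of a `k`-algebra, where `k` is a field of characteristic `p`
(the algebra may be zero). -/
def powHom (A : Type u) [CommRing A] [Algebra k A] : A →+* A where
  toFun x := x ^ p
  map_one' := one_pow p
  map_mul' x y := mul_pow x y p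
  map_zero' := zero_pow (Fact.out : p.Prime).ne_zero
  map_add' x y := by
    rcases subsingleton_or_nontrivial A with h | h
    · exact Subsingleton.elim _ _
    · have : CharP A p := charP_of_injective_algebraMap (algebraMap k A).injective p
      exact add_pow_char x y p

variable {p}

/-- The ring homomorphism `W_n(A) → W_n(B)` induced by a ring homomorphism `A → B`. -/
def wittMap (n : ℕ) {A B : Type u} [CommRing A] [CommRing B] (f : A →+* B) :
    TruncatedWittVector p n A →+* TruncatedWittVector p n B :=
  have key (x : WittVector p A) :
      (TruncatedWittVector.mk p fun i => f ((WittVector.truncate n x).coeff i)) =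
        WittVector.truncate n (WittVector.map f x) := by
    ext i; simp
  have hs := WittVector.truncate_surjective p n A
  { toFun := fun x => TruncatedWittVector.mk p fun i => f (x.coeff i)
    map_one' := by
      have := key 1
      simpa using this
    map_zero' := by
      have := key 0
      simpa using this
    map_mul' := fun x y => by
      obtain ⟨x, rfl⟩ := hs x
      obtain ⟨y, rfl⟩ := hs y
      rw [← map_mul, key, key, key, map_mul, map_mul]
    map_add' := fun x y => by
      obtain ⟨x, rfl⟩ := hs x
      obtain ⟨y, rfl⟩ := hs y
      rw [← map_add, key, key, key, map_add, map_add] }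

@[simp]
lemma coeff_wittMap {n : ℕ} {A B : Type u} [CommRing A] [CommRing B] (f : A →+* B)
    (x : TruncatedWittVector p n A) (i : Fin n) :
    (wittMap n f x).coeff i = f (x.coeff i) := by
  simp [wittMap]

lemma wittMap_truncate {n : ℕ} {A B : Type u} [CommRing A] [CommRing B] (f : A →+* B)
    (x : WittVector p A) :
    wittMap n f (WittVector.truncate n x) = WittVector.truncate n (WittVector.map f x) := by
  ext i; simp

/-- The Frobenius `F : W_n(A) → W_n(A)`, which raises every component to the `p`-th power. -/
def wittF (n : ℕ) (A : Type u) [CommRing A] [Algebra k A] :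
    TruncatedWittVector p n A →+* TruncatedWittVector p n A :=
  wittMap n (powHom p k A)

lemma coeff_verschiebung_of_init {n : ℕ} {A : Type u} [CommRing A] {x y : WittVector p A}
    (h : WittVector.truncate n x = WittVector.truncate n y) :
    WittVector.truncate n (WittVector.verschiebung x) =
      WittVector.truncate n (WittVector.verschiebung y) := by
  ext i
  rcases i with ⟨_ | i, hi⟩
  · simp
  · have := congrArg (fun z => TruncatedWittVector.coeff ⟨i, by omega⟩ z) h
    simpa [WittVector.verschiebung_coeff_succ] using this

/-- The Verschiebung `V : W_n(A) → W_n(A)`, `(x₀, …, xₙ₋₁) ↦ (0, x₀, …, xₙ₋₂)`. -/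
def wittV (n : ℕ) (A : Type u) [CommRing A] :
    TruncatedWittVector p n A →+ TruncatedWittVector p n A :=
  AddMonoidHom.mk' (fun x => WittVector.truncate n (WittVector.verschiebung x.out)) fun x y => by
    rw [← map_add, ← map_add]
    refine coeff_verschiebung_of_init ?_
    rw [map_add]
    exact (TruncatedWittVector.truncateFun_out _).trans
      (congrArg₂ _ (TruncatedWittVector.truncateFun_out _).symm
        (TruncatedWittVector.truncateFun_out _).symm)

lemma wittV_truncate {n : ℕ} {A : Type u} [CommRing A] (x : WittVector p A) :
    wittV n A (WittVector.truncate n x) = WittVector.truncate n (WittVector.verschiebung x) :=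
  coeff_verschiebung_of_init (TruncatedWittVector.truncateFun_out _)

lemma wittF_truncate {n : ℕ} {A : Type u} [CommRing A] [Algebra k A] (x : WittVector p A) :
    wittF k n A (WittVector.truncate n x) = WittVector.truncate n (WittVector.frobenius x) := by
  rcases subsingleton_or_nontrivial A with h | h
  · ext i; exact Subsingleton.elim _ _
  · have : CharP A p := charP_of_injective_algebraMap (algebraMap k A).injective p
    ext i
    simp [wittF, powHom, WittVector.coeff_frobenius_charP]

lemma wittMap_wittV {n : ℕ} {A B : Type u} [CommRing A] [CommRing B] (f : A →+* B)
    (x : TruncatedWittVector p n A) : wittMap n f (wittV n A x) = wittV n B (wittMap n f x) := by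
  obtain ⟨x, rfl⟩ := WittVector.truncate_surjective p n A x
  rw [wittV_truncate, wittMap_truncate, wittMap_truncate, wittV_truncate,
    WittVector.map_verschiebung]

lemma wittMap_wittF {n : ℕ} {A B : Type u} [CommRing A] [CommRing B] [Algebra k A] [Algebra k B]
    (f : A →+* B) (x : TruncatedWittVector p n A) :
    wittMap n f (wittF k n A x) = wittF k n B (wittMap n f x) := by
  ext i; simp [wittF, powHom]

lemma wittF_wittV {n : ℕ} {A : Type u} [CommRing A] [Algebra k A]
    (x : TruncatedWittVector p n A) : wittF k n A (wittV n A x) = p • x := by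
  obtain ⟨x, rfl⟩ := WittVector.truncate_surjective p n A x
  rw [wittV_truncate, wittF_truncate, WittVector.frobenius_verschiebung, ← map_nsmul,
    nsmul_eq_mul, mul_comm]

lemma wittV_wittF {n : ℕ} {A : Type u} [CommRing A] [Algebra k A]
    (x : TruncatedWittVector p n A) : wittV n A (wittF k n A x) = p • x := by
  rcases subsingleton_or_nontrivial A with h | h
  · ext i; exact Subsingleton.elim _ _
  · have : CharP A p := charP_of_injective_algebraMap (algebraMap k A).injective p
    obtain ⟨x, rfl⟩ := WittVector.truncate_surjective p n A x
    rw [wittF_truncate, wittV_truncate, WittVector.verschiebung_frobenius, ← map_nsmul,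
      nsmul_eq_mul, mul_comm]

/-- The canonical ring homomorphism `W(k) → W_n(A)` for a `k`-algebra `A`. -/
def wittAlg (n : ℕ) (A : Type u) [CommRing A] [Algebra k A] :
    WittVector p k →+* TruncatedWittVector p n A :=
  (WittVector.truncate n).comp (WittVector.map (algebraMap k A))

lemma wittMap_wittAlg {n : ℕ} {A B : Type u} [CommRing A] [CommRing B] [Algebra k A] [Algebra k B]
    (f : A →ₐ[k] B) (a : WittVector p k) :
    wittMap n (f : A →+* B) (wittAlg k n A a) = wittAlg k n B a := by
  ext i; simp [wittAlg]

lemma wittF_wittAlg {n : ℕ} {A : Type u} [CommRing A] [Algebra k A] (a : WittVector p k) :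
    wittF k n A (wittAlg k n A a) = wittAlg k n A (WittVector.frobenius a) := by
  ext i; simp [wittF, powHom, wittAlg, WittVector.coeff_frobenius_charP]

lemma wittV_mul_wittF {n : ℕ} {A : Type u} [CommRing A] [Algebra k A]
    (x y : TruncatedWittVector p n A) :
    wittV n A (wittF k n A y * x) = y * wittV n A x := by
  obtain ⟨x, rfl⟩ := WittVector.truncate_surjective p n A x
  obtain ⟨y, rfl⟩ := WittVector.truncate_surjective p n A y
  rw [wittF_truncate, ← map_mul, wittV_truncate, wittV_truncate, ← map_mul, mul_comm,
    WittVector.verschiebung_mul_frobenius, mul_comm]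

end Witt

/-! ### The Dieudonné ring -/

section Dieudonne

variable (p : ℕ) [Fact p.Prime] (k : Type u) [Field k] [CharP k p]

/-- The generators of the Dieudonné ring: the elements of `W(k)`, and `F` and `V`. -/
inductive DieudonneGen : Type u
  | scalar (a : WittVector p k)
  | frob
  | ver

/-- The defining relations of the Dieudonné ring. The first three say that `W(k)` is a subring
up to the other relations, the others are `FV = VF = p`, `Fa = σ(a)F` and `aV = Vσ(a)`. -/
inductive DieudonneRel :
    FreeAlgebra ℤ (DieudonneGen p k) → FreeAlgebra ℤ (DieudonneGen p k) → Prop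
  | one : DieudonneRel (.ι ℤ (.scalar 1)) 1
  | add (a b : WittVector p k) :
      DieudonneRel (.ι ℤ (.scalar (a + b))) (.ι ℤ (.scalar a) + .ι ℤ (.scalar b))
  | mul (a b : WittVector p k) :
      DieudonneRel (.ι ℤ (.scalar (a * b))) (.ι ℤ (.scalar a) * .ι ℤ (.scalar b))
  | frob_ver : DieudonneRel (.ι ℤ .frob * .ι ℤ .ver) (p : FreeAlgebra ℤ (DieudonneGen p k))
  | ver_frob : DieudonneRel (.ι ℤ .ver * .ι ℤ .frob) (p : FreeAlgebra ℤ (DieudonneGen p k))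
  | frob_scalar (a : WittVector p k) :
      DieudonneRel (.ι ℤ .frob * .ι ℤ (.scalar a))
        (.ι ℤ (.scalar (WittVector.frobenius a)) * .ι ℤ .frob)
  | scalar_ver (a : WittVector p k) :
      DieudonneRel (.ι ℤ (.scalar a) * .ι ℤ .ver)
        (.ι ℤ .ver * .ι ℤ (.scalar (WittVector.frobenius a)))

/-- The Dieudonné ring `𝔻 = W(k){F, V}/(FV = VF = p, Fa = σ(a)F, aV = Vσ(a))`. -/
def DieudonneRing : Type u := RingQuot (DieudonneRel p k)

instance : Ring (DieudonneRing p k) := inferInstanceAs (Ring (RingQuot (DieudonneRel p k)))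

namespace DieudonneRing

/-- The class of a generator in the Dieudonné ring. -/
def gen (g : DieudonneGen p k) : DieudonneRing p k :=
  RingQuot.mkRingHom (DieudonneRel p k) (.ι ℤ g)

/-- The element `F` of the Dieudonné ring. -/
def F : DieudonneRing p k := gen p k .frob

/-- The element `V` of the Dieudonné ring. -/
def V : DieudonneRing p k := gen p k .ver

variable {p k}

/-- The ring homomorphism out of the Dieudonné ring that is determined by the images of `W(k)`,
`F` and `V`. -/
def lift {E : Type u} [Ring E] (c : WittVector p k →+* E) (f v : E) (hfv : f * v = p)
    (hvf : v * f = p) (hf : ∀ a, f * c a = c (WittVector.frobenius a) * f)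
    (hv : ∀ a, c a * v = v * c (WittVector.frobenius a)) : DieudonneRing p k →+* E :=
  RingQuot.lift ⟨(FreeAlgebra.lift ℤ fun g : DieudonneGen p k => match g with
      | .scalar a => c a
      | .frob => f
      | .ver => v : FreeAlgebra ℤ (DieudonneGen p k) →ₐ[ℤ] E).toRingHom, fun x y h => by
    cases h <;> simp [hfv, hvf, hf, hv]⟩

lemma lift_gen {E : Type u} [Ring E] (c : WittVector p k →+* E) (f v : E) (hfv : f * v = p)
    (hvf : v * f = p) (hf : ∀ a, f * c a = c (WittVector.frobenius a) * f)
    (hv : ∀ a, c a * v = v * c (WittVector.frobenius a)) (g : DieudonneGen p k) :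
    lift c f v hfv hvf hf hv (gen p k g) = match g with
      | .scalar a => c a
      | .frob => f
      | .ver => v := by
  simp only [lift, gen]
  erw [RingQuot.lift_mkRingHom_apply]
  cases g <;> simp

lemma induction {P : DieudonneRing p k → Prop} (hi : ∀ i : ℤ, P i) (hg : ∀ g, P (gen p k g))
    (ha : ∀ x y, P x → P y → P (x + y)) (hm : ∀ x y, P x → P y → P (x * y))
    (x : DieudonneRing p k) : P x := by
  obtain ⟨x, rfl⟩ := RingQuot.mkRingHom_surjective (DieudonneRel p k) x
  induction x using FreeAlgebra.induction with
  | grade0 r =>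
    have h := eq_intCast (((RingQuot.mkRingHom (DieudonneRel p k)).comp
      (algebraMap ℤ (FreeAlgebra ℤ (DieudonneGen p k))) : ℤ →+* DieudonneRing p k)) r
    rw [RingHom.comp_apply] at h
    rw [h]
    exact hi r
  | grade1 g => exact hg g
  | mul a b h h' => rw [map_mul]; exact hm _ _ h h'
  | add a b h h' => rw [map_add]; exact ha _ _ h h'

lemma F_mul_exists (d : DieudonneRing p k) : ∃ d', F p k * d = d' * F p k := by
  induction d using induction with
  | hi i => exact ⟨i, (Int.cast_comm i _).symm⟩
  | hg g =>
    cases g with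
    | scalar a =>
      exact ⟨gen p k (.scalar (WittVector.frobenius a)), by
        have := RingQuot.mkRingHom_rel (DieudonneRel.frob_scalar (p := p) (k := k) a)
        rwa [map_mul, map_mul] at this⟩
    | frob => exact ⟨F p k, rfl⟩
    | ver =>
      refine ⟨V p k, ?_⟩
      have h1 := RingQuot.mkRingHom_rel (DieudonneRel.frob_ver (p := p) (k := k))
      have h2 := RingQuot.mkRingHom_rel (DieudonneRel.ver_frob (p := p) (k := k))
      have := h1.trans h2.symm
      rwa [map_mul, map_mul] at this
  | ha x y hx hy =>
    obtain ⟨x', hx⟩ := hx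
    obtain ⟨y', hy⟩ := hy
    exact ⟨x' + y', by rw [mul_add, add_mul, hx, hy]⟩
  | hm x y hx hy =>
    obtain ⟨x', hx⟩ := hx
    obtain ⟨y', hy⟩ := hy
    exact ⟨x' * y', by rw [← mul_assoc, hx, mul_assoc, hy, mul_assoc]⟩

lemma F_pow_mul_exists (m : ℕ) (d : DieudonneRing p k) : ∃ d', F p k ^ m * d = d' * F p k ^ m := by
  induction m with
  | zero => exact ⟨d, by simp⟩
  | succ m ih =>
    obtain ⟨d', h⟩ := ih
    obtain ⟨d'', h'⟩ := F_mul_exists d'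
    exact ⟨d'', by rw [pow_succ', mul_assoc, h, ← mul_assoc, h', mul_assoc]⟩

end DieudonneRing

variable {p k} in
/-- The submodule `M[F^m]` of a left `𝔻`-module `M`, the kernel of `F^m`. -/
def frobKer (m : ℕ) (M : Type*) [AddCommGroup M] [Module (DieudonneRing p k) M] :
    Submodule (DieudonneRing p k) M where
  carrier := {x | DieudonneRing.F p k ^ m • x = 0}
  zero_mem' := smul_zero _
  add_mem' {x y} hx hy := by
    simp only [Set.mem_ofPred_eq] at *
    rw [smul_add, hx, hy, add_zero]
  smul_mem' d x hx := by
    simp only [Set.mem_ofPred_eq] at *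
    obtain ⟨d', h⟩ := DieudonneRing.F_pow_mul_exists m d
    rw [← mul_smul, h, mul_smul, hx, smul_zero]

/-- The functor `M ↦ M[F^m]` on left `𝔻`-modules. -/
def frobKerFunctor (m : ℕ) : ModuleCat.{u} (DieudonneRing p k) ⥤ ModuleCat.{u} (DieudonneRing p k) where
  obj M := ModuleCat.of _ (frobKer (p := p) (k := k) m M)
  map f := ModuleCat.ofHom (f.hom.restrict fun x hx => by
    change _ • _ = _ at hx
    change _ • _ = _
    rw [← map_smul, hx, map_zero])

/-- The inclusion `M[F^m] → M`. -/
def frobKerι (m : ℕ) : frobKerFunctor p k m ⟶ 𝟭 _ where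
  app M := ModuleCat.ofHom (frobKer (p := p) (k := k) m M).subtype

variable [PerfectRing k p]

lemma frobeniusEquiv_symm_pow_comm (n : ℕ) (a : WittVector p k) :
    WittVector.frobenius (((WittVector.frobeniusEquiv p k).symm ^ n :
        WittVector p k ≃+* WittVector p k) a) =
      ((WittVector.frobeniusEquiv p k).symm ^ n : WittVector p k ≃+* WittVector p k)
        (WittVector.frobenius a) := by
  let e : RingAut (WittVector p k) := WittVector.frobeniusEquiv p k
  have h : Commute e (e⁻¹ ^ n) := (Commute.refl e).inv_right.pow_right n
  exact congrArg (fun g : RingAut (WittVector p k) => g a) h.eq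

/-- The action of the Dieudonné ring on `W_n(A)` for a `k`-algebra `A`: the elements `F` and `V`
act as Frobenius and Verschiebung, and `a ∈ W(k)` acts as multiplication by `σ⁻ⁿ(a)`. -/
def wittAction (n : ℕ) (A : Type u) [CommRing A] [Algebra k A] :
    DieudonneRing p k →+* AddMonoid.End (TruncatedWittVector p n A) :=
  DieudonneRing.lift
    ((Module.toAddMonoidEnd (TruncatedWittVector p n A) (TruncatedWittVector p n A)).comp
      ((wittAlg k n A).comp (((WittVector.frobeniusEquiv p k).symm ^ n :
        WittVector p k ≃+* WittVector p k) : WittVector p k →+* WittVector p k)))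
    (wittF k n A : TruncatedWittVector p n A →+* TruncatedWittVector p n A).toAddMonoidHom
    (wittV n A)
    (by ext1 x; rw [AddMonoid.End.natCast_apply]; exact wittF_wittV k x)
    (by ext1 x; rw [AddMonoid.End.natCast_apply]; exact wittV_wittF k x)
    (fun a => by
      ext1 x
      change wittF k n A (wittAlg k n A _ * x) = wittAlg k n A _ * wittF k n A x
      rw [map_mul, wittF_wittAlg]
      congr 2
      exact frobeniusEquiv_symm_pow_comm p k n a)
    (fun a => by
      ext1 x
      change wittAlg k n A _ * wittV n A x = wittV n A (wittAlg k n A _ * x)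
      rw [← wittV_mul_wittF k, wittF_wittAlg]
      congr 3
      exact frobeniusEquiv_symm_pow_comm p k n a)

lemma wittAction_scalar {n : ℕ} {A : Type u} [CommRing A] [Algebra k A] (a : WittVector p k)
    (x : TruncatedWittVector p n A) :
    wittAction p k n A (DieudonneRing.gen p k (.scalar a)) x =
      wittAlg k n A (((WittVector.frobeniusEquiv p k).symm ^ n :
        WittVector p k ≃+* WittVector p k) a) * x :=
  congrArg (fun g : AddMonoid.End (TruncatedWittVector p n A) => g x)
    (DieudonneRing.lift_gen _ _ _ _ _ _ _ (.scalar a))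

lemma wittAction_frob {n : ℕ} {A : Type u} [CommRing A] [Algebra k A]
    (x : TruncatedWittVector p n A) :
    wittAction p k n A (DieudonneRing.gen p k .frob) x = wittF k n A x :=
  congrArg (fun g : AddMonoid.End (TruncatedWittVector p n A) => g x)
    (DieudonneRing.lift_gen _ _ _ _ _ _ _ .frob)

lemma wittAction_ver {n : ℕ} {A : Type u} [CommRing A] [Algebra k A]
    (x : TruncatedWittVector p n A) :
    wittAction p k n A (DieudonneRing.gen p k .ver) x = wittV n A x :=
  congrArg (fun g : AddMonoid.End (TruncatedWittVector p n A) => g x)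
    (DieudonneRing.lift_gen _ _ _ _ _ _ _ .ver)

lemma wittMap_wittAction {n : ℕ} {A B : Type u} [CommRing A] [CommRing B] [Algebra k A]
    [Algebra k B] (f : A →ₐ[k] B) (d : DieudonneRing p k) (x : TruncatedWittVector p n A) :
    wittMap n (f : A →+* B) (wittAction p k n A d x) =
      wittAction p k n B d (wittMap n (f : A →+* B) x) := by
  induction d using DieudonneRing.induction generalizing x with
  | hi i => simp only [map_intCast, AddMonoid.End.intCast_apply, map_zsmul]
  | hg g =>
    cases g with
    | scalar a =>
      rw [wittAction_scalar, wittAction_scalar, map_mul, wittMap_wittAlg]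
    | frob => rw [wittAction_frob, wittAction_frob, wittMap_wittF]
    | ver => rw [wittAction_ver, wittAction_ver, wittMap_wittV]
  | ha a b h h' =>
    rw [map_add, map_add]
    exact (map_add _ _ _).trans (congrArg₂ _ (h x) (h' x))
  | hm a b h h' =>
    rw [map_mul, map_mul]
    exact (h _).trans (congrArg _ (h' x))

/-- The left `𝔻`-module `W_n(A)` of a `k`-algebra `A`. -/
def WittModule (n : ℕ) (A : Type u) [CommRing A] [Algebra k A] : Type u :=
  TruncatedWittVector p n A

instance (n : ℕ) (A : Type u) [CommRing A] [Algebra k A] : AddCommGroup (WittModule p k n A) :=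
  inferInstanceAs (AddCommGroup (TruncatedWittVector p n A))

instance (n : ℕ) (A : Type u) [CommRing A] [Algebra k A] :
    Module (DieudonneRing p k) (WittModule p k n A) :=
  Module.compHom (TruncatedWittVector p n A) (wittAction p k n A)

variable {k} in
/-- The `𝔻`-linear map `W_n(A) → W_n(B)` induced by a homomorphism of `k`-algebras `A → B`. -/
def WittModule.map (n : ℕ) {A B : Type u} [CommRing A] [CommRing B] [Algebra k A] [Algebra k B]
    (f : A →ₐ[k] B) : WittModule p k n A →ₗ[DieudonneRing p k] WittModule p k n B where
  toFun := wittMap (p := p) n (f : A →+* B)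
  map_add' := map_add (wittMap (p := p) n (f : A →+* B))
  map_smul' d x := wittMap_wittAction p k f d x

lemma WittModule.map_id (n : ℕ) (A : Type u) [CommRing A] [Algebra k A] :
    WittModule.map p n (AlgHom.id k A) = LinearMap.id := by
  apply LinearMap.ext
  intro x
  apply TruncatedWittVector.ext
  intro i
  exact coeff_wittMap (p := p) (AlgHom.id k A : A →+* A) x i

variable {k} in
lemma WittModule.map_comp (n : ℕ) {A B C : Type u} [CommRing A] [CommRing B] [CommRing C]
    [Algebra k A] [Algebra k B] [Algebra k C] (f : A →ₐ[k] B) (g : B →ₐ[k] C) :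
    WittModule.map p n (g.comp f) = (WittModule.map p n g).comp (WittModule.map p n f) := by
  apply LinearMap.ext
  intro x
  apply TruncatedWittVector.ext
  intro i
  refine (coeff_wittMap (p := p) _ _ _).trans ?_
  refine Eq.trans ?_ (coeff_wittMap (p := p) _ _ _).symm
  exact congrArg g (coeff_wittMap (p := p) (f : A →+* B) x i).symm

/-- The functor `A ↦ W_n(A)` from `k`-algebras to left `𝔻`-modules. -/
def wittFunctor (n : ℕ) : CommAlgCat.{u} k ⥤ ModuleCat.{u} (DieudonneRing p k) where
  obj A := ModuleCat.of _ (WittModule p k n A)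
  map f := ModuleCat.ofHom (WittModule.map p n f.hom)
  map_id A := congrArg ModuleCat.ofHom (WittModule.map_id p k n A)
  map_comp f g := congrArg ModuleCat.ofHom (WittModule.map_comp p n f.hom g.hom)

end Dieudonne

/-! ### Kan extensions -/

section KanExtension

universe v₁ u₁ v₂ u₂ v₃ u₃
variable {C : Type u₁} [Category.{v₁} C] {D : Type u₂} [Category.{v₂} D] {E : Type u₃}
  [Category.{v₃} E]

/-- The values of a left Kan extension are colimits over costructured arrows. -/
def lanEvaluationIso (F : C ⥤ D) (K : D) [∀ K : D, HasColimitsOfShape (CostructuredArrow F K) E] :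
    (F.lan : (C ⥤ E) ⥤ _) ⋙ (evaluation _ E).obj K ≅
      (Functor.whiskeringLeft _ _ E).obj (CostructuredArrow.proj F K) ⋙ colim :=
  let hc (G : C ⥤ E) : IsColimit ((Functor.LeftExtension.mk (F.leftKanExtension G)
    (F.leftKanExtensionUnit G)).coconeAt K) :=
      Functor.isPointwiseLeftKanExtensionLeftKanExtensionUnit F G K
  let e (G : C ⥤ E) : (F.leftKanExtension G).obj K ≅ colimit (CostructuredArrow.proj F K ⋙ G) :=
    IsColimit.coconePointUniqueUpToIso (hc G) (colimit.isColimit _)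
  have he (G : C ⥤ E) (T : CostructuredArrow F K) :
      (F.leftKanExtensionUnit G).app T.left ≫ (F.leftKanExtension G).map T.hom ≫ (e G).hom =
        colimit.ι (CostructuredArrow.proj F K ⋙ G) T := by
    rw [← Category.assoc]
    exact IsColimit.comp_coconePointUniqueUpToIso_hom (hc G) (colimit.isColimit _) T
  have key {G₁ G₂ : C ⥤ E} (φ : G₁ ⟶ G₂) (ψ : F.leftKanExtension G₁ ⟶ F.leftKanExtension G₂)
      (hψ : ∀ c, (F.leftKanExtensionUnit G₁).app c ≫ ψ.app (F.obj c) =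
        φ.app c ≫ (F.leftKanExtensionUnit G₂).app c) :
      ψ.app K ≫ (e G₂).hom =
        (e G₁).hom ≫ colimMap (Functor.whiskerLeft (CostructuredArrow.proj F K) φ) := by
    apply (hc G₁).hom_ext
    intro T
    change ((F.leftKanExtensionUnit G₁).app T.left ≫ (F.leftKanExtension G₁).map T.hom) ≫
        ψ.app K ≫ (e G₂).hom =
      ((F.leftKanExtensionUnit G₁).app T.left ≫ (F.leftKanExtension G₁).map T.hom) ≫
        (e G₁).hom ≫ colimMap (Functor.whiskerLeft (CostructuredArrow.proj F K) φ)
    have h1 := he G₁ T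
    have h2 := he G₂ T
    have h3 := hψ T.left
    simp only [Category.assoc]
    rw [reassoc_of% h1, ψ.naturality_assoc, reassoc_of% h3, h2]
    exact (ι_colimMap (Functor.whiskerLeft (CostructuredArrow.proj F K) φ) T).symm
  NatIso.ofComponents e fun φ =>
    key φ (F.lan.map φ) fun c => (congr_app (F.lanUnit.naturality φ) c).symm

end KanExtension

/-! ### The small Zariski site and the big fppf site of a scheme -/

section Sites

variable (X : Scheme.{u})

/-- The small Zariski site of `X`: the open subsets of `X`. -/
abbrev zarTop : GrothendieckTopology X.Opens := Opens.grothendieckTopology X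

/-- The big fppf site of `X`: the category of all `X`-schemes with the fppf topology. -/
abbrev flTop : GrothendieckTopology (Over X) := Scheme.fppfTopology.over X

instance hasSheafifyZar : HasSheafify (zarTop X) AddCommGrpCat.{u + 1} := by
  have : EssentiallySmall.{u + 1} X.Opens := inferInstance
  exact hasSheafifyEssentiallySmallSite _ _

instance grothendieckAbelianZar :
    IsGrothendieckAbelian.{u + 1} (Sheaf (zarTop X) AddCommGrpCat.{u + 1}) := by
  have : EssentiallySmall.{u + 1} X.Opens := inferInstance
  exact Sheaf.isGrothendieckAbelian_of_essentiallySmall (zarTop X) AddCommGrpCat.{u + 1}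

instance grothendieckAbelianFl :
    IsGrothendieckAbelian.{u + 1} (Sheaf (flTop X) AddCommGrpCat.{u + 1}) := by
  have : EssentiallySmall.{u + 1} (Over X) := inferInstance
  exact Sheaf.isGrothendieckAbelian_of_essentiallySmall (flTop X) AddCommGrpCat.{u + 1}

instance hasExtZar : HasExt.{u + 1} (Sheaf (zarTop X) AddCommGrpCat.{u + 1}) := inferInstance

instance hasExtFl : HasExt.{u + 1} (Sheaf (flTop X) AddCommGrpCat.{u + 1}) := inferInstance

/-- An `X`-scheme whose image in `X` lies in the open subset `U` is a `U`-scheme. -/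
def toRestrict (T : Over X) (U : X.Opens) (h : Set.range T.hom ⊆ U) :
    T ⟶ X.restrictFunctor.obj U :=
  let g : T.left ⟶ U.toScheme := IsOpenImmersion.lift U.ι T.hom (by simpa using h)
  have hg : g ≫ U.ι = T.hom := IsOpenImmersion.lift_fac U.ι T.hom _
  Over.homMk g hg

instance (T : Over X) (U : X.Opens) : Subsingleton (T ⟶ X.restrictFunctor.obj U) where
  allEq f g := by
    ext1
    have h (a b : T.left ⟶ U.toScheme) (hab : a ≫ U.ι = b ≫ U.ι) : a = b := by
      rwa [cancel_mono] at hab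
    exact h f.left g.left ((Over.w f).trans (Over.w g).symm)

lemma range_subset_of_hom {T : Over X} {U : X.Opens} (f : T ⟶ X.restrictFunctor.obj U) :
    Set.range T.hom ⊆ U := by
  rintro _ ⟨x, rfl⟩
  rw [← Over.w f]
  have := Set.mem_range_self (f := Scheme.Opens.ι U) (f.left x)
  rw [Scheme.Opens.range_ι] at this
  simpa using! this

instance representablyFlatRestrict : RepresentablyFlat X.restrictFunctor where
  cofiltered T := by
    have : Nonempty (StructuredArrow T X.restrictFunctor) :=
      ⟨StructuredArrow.mk (Y := (⊤ : X.Opens)) (toRestrict X T ⊤ (Set.subset_univ _))⟩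
    suffices IsCofilteredOrEmpty (StructuredArrow T X.restrictFunctor) by constructor
    refine ⟨fun A B => ?_, fun A B f g => ⟨A, 𝟙 A, ?_⟩⟩
    · exact ⟨StructuredArrow.mk (Y := (A.right ⊓ B.right : X.Opens))
        (toRestrict X T _ (Set.subset_inter (range_subset_of_hom X A.hom)
          (range_subset_of_hom X B.hom))),
        StructuredArrow.homMk (homOfLE inf_le_left) (Subsingleton.elim _ _),
        StructuredArrow.homMk (homOfLE inf_le_right) (Subsingleton.elim _ _), trivial⟩
    · exact StructuredArrow.ext _ _ (Subsingleton.elim _ _)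

instance continuousRestrict : X.restrictFunctor.IsContinuous (zarTop X) (flTop X) := by
  refine Functor.isContinuous_of_coverPreserving (compatiblePreservingOfFlat _ _)
    ⟨fun {U S} hS => ?_⟩
  rw [GrothendieckTopology.mem_over_iff]
  choose V f hf hx using fun x : Scheme.Opens.toScheme U => hS x.1 x.2
  have h : Presieve.ofArrows (fun x => Scheme.Opens.toScheme (V x))
      (fun x => X.homOfLE (f x).le) ∈ Scheme.fppfPrecoverage (Scheme.Opens.toScheme U) := by
    apply Scheme.zariskiPrecoverage_le_fppfPrecoverage
    refine (Scheme.ofArrows_mem_precoverage_iff _).mpr ⟨fun x => ⟨x, ?_⟩, fun x =>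
      inferInstanceAs (IsOpenImmersion (X.homOfLE (f x).le))⟩
    exact ⟨⟨x.1, hx x⟩, Subtype.ext (by rw [Scheme.homOfLE_apply])⟩
  refine GrothendieckTopology.superset_covering _ ?_ (Precoverage.generate_mem_toGrothendieck h)
  refine (Sieve.generate_le_iff _ _).mpr ?_
  rintro _ _ ⟨x⟩
  refine (Sieve.overEquiv_iff (Y := X.restrictFunctor.obj U) _ _).mpr ?_
  refine ⟨V x, f x, Over.homMk (𝟙 _) ?_, hf x, Subsingleton.elim _ _⟩
  exact (Category.id_comp _).trans (X.homOfLE_ι (f x).le).symm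

/-- The restriction of sheaves of abelian groups from the big fppf site of `X` to the small Zariski
site of `X`, `G ↦ (U ↦ G(U))`. -/
abbrev toZar : Sheaf (flTop X) AddCommGrpCat.{u + 1} ⥤ Sheaf (zarTop X) AddCommGrpCat.{u + 1} :=
  X.restrictFunctor.sheafPushforwardContinuous AddCommGrpCat.{u + 1} (zarTop X) (flTop X)

lemma preservesFiniteLimits_colim (K : (Over X)ᵒᵖ) :
    PreservesFiniteLimits (colim :
      (CostructuredArrow X.restrictFunctor.op K ⥤ AddCommGrpCat.{u + 1}) ⥤ _) := by
  have : IsFiltered (CostructuredArrow X.restrictFunctor.op K) :=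
    IsFiltered.of_equivalence (structuredArrowOpEquivalence X.restrictFunctor (Opposite.unop K))
  have := AB5OfSize_of_univLE.{u, u, u + 1, u + 1} AddCommGrpCat.{u + 1}
  infer_instance

instance preservesFiniteLimits_lan : PreservesFiniteLimits
    (X.restrictFunctor.op.lan : (X.Opensᵒᵖ ⥤ AddCommGrpCat.{u + 1}) ⥤ _) := by
  apply preservesFiniteLimits_of_evaluation
  intro K
  have := preservesFiniteLimits_colim X K
  have : PreservesFiniteLimits ((Functor.whiskeringLeft _ _ AddCommGrpCat.{u + 1}).obj
      (CostructuredArrow.proj X.restrictFunctor.op K)) := ⟨fun _ => inferInstance⟩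
  have := comp_preservesFiniteLimits ((Functor.whiskeringLeft _ _ AddCommGrpCat.{u + 1}).obj
      (CostructuredArrow.proj X.restrictFunctor.op K)) colim
  exact preservesFiniteLimits_of_natIso (lanEvaluationIso X.restrictFunctor.op K).symm

/-- The inverse image functor from sheaves on the small Zariski site to sheaves on the big fppf
site, which is left adjoint to `toZar`. -/
abbrev fromZar : Sheaf (zarTop X) AddCommGrpCat.{u + 1} ⥤ Sheaf (flTop X) AddCommGrpCat.{u + 1} :=
  X.restrictFunctor.sheafPullback AddCommGrpCat.{u + 1} (zarTop X) (flTop X)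

/-- The adjunction between inverse image and restriction. -/
abbrev zarAdj : fromZar X ⊣ toZar X :=
  X.restrictFunctor.sheafAdjunctionContinuous AddCommGrpCat.{u + 1} (zarTop X) (flTop X)

instance : (toZar X).Additive where

instance : (fromZar X).Additive := (zarAdj X).left_adjoint_additive

instance : PreservesFiniteLimits (fromZar X) :=
  Functor.sheafPullbackConstruction.preservesFiniteLimits _ _ _ _

instance : PreservesFiniteColimits (fromZar X) :=
  have := (zarAdj X).leftAdjoint_preservesColimits
  inferInstance

end Sites

/-! ### Sheaves of Witt vectors -/

section StructureSheaf

/-- Ring homomorphisms out of a polynomial ring in one variable over `ℤ`. -/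
def polyEquiv (A : Type u) [CommRing A] :
    (MvPolynomial PUnit.{u + 1} (ULift.{u} ℤ) →+* A) ≃ A where
  toFun f := f (MvPolynomial.X PUnit.unit)
  invFun a := MvPolynomial.eval₂Hom
    ((Int.castRingHom A).comp (ULift.ringEquiv : ULift.{u} ℤ ≃+* ℤ).toRingHom) fun _ => a
  left_inv f := by
    apply MvPolynomial.ringHom_ext
    · intro r
      have h : (MvPolynomial.C r : MvPolynomial PUnit.{u + 1} (ULift.{u} ℤ)) = (r.down : ℤ) := by
        have : r = ((r.down : ℤ) : ULift.{u} ℤ) := rfl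
        rw [this, map_intCast]
        rfl
      rw [h, map_intCast, map_intCast]
    · intro i
      simp
  right_inv a := by simp

/-- Morphisms to the affine line are global functions. -/
def gammaEquiv (T : Scheme.{u}) :
    (T ⟶ Spec (CommRingCat.of (MvPolynomial PUnit.{u + 1} (ULift.{u} ℤ)))) ≃ Γ(T, ⊤) where
  toFun f := polyEquiv Γ(T, ⊤) ((Scheme.ΓSpecIso _).inv ≫ f.appTop).hom
  invFun a := T.toSpecΓ ≫ Spec.map (CommRingCat.ofHom ((polyEquiv Γ(T, ⊤)).symm a))
  left_inv f := by
    beta_reduce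
    rw [Equiv.symm_apply_apply]
    change T.toSpecΓ ≫ Spec.map ((Scheme.ΓSpecIso _).inv ≫ f.appTop) = f
    simp [← Scheme.toSpecΓ_naturality_assoc]
  right_inv a := by
    have h : (Scheme.ΓSpecIso _).inv ≫ (T.toSpecΓ ≫ Spec.map (CommRingCat.ofHom
        ((polyEquiv Γ(T, ⊤)).symm a))).appTop =
        CommRingCat.ofHom ((polyEquiv Γ(T, ⊤)).symm a) := by
      simp
    beta_reduce
    rw [h, CommRingCat.hom_ofHom, Equiv.apply_symm_apply]

/-- The functor of global functions is represented by the affine line. -/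
def gammaRepresentableBy : (Scheme.Γ.{u} ⋙ forget CommRingCat.{u}).RepresentableBy
    (Spec (CommRingCat.of (MvPolynomial PUnit.{u + 1} (ULift.{u} ℤ)))) where
  homEquiv {T} := gammaEquiv T
  homEquiv_comp {T T'} f g := by
    change polyEquiv Γ(T, ⊤) ((Scheme.ΓSpecIso _).inv ≫ (f ≫ g).appTop).hom =
      f.appTop.hom (polyEquiv Γ(T', ⊤) ((Scheme.ΓSpecIso _).inv ≫ g.appTop).hom)
    rw [Scheme.Hom.comp_appTop]
    rfl

lemma isSheaf_gamma :
    Presieve.IsSheaf Scheme.fppfTopology.{u} (Scheme.Γ.{u} ⋙ forget CommRingCat.{u}) := by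
  have : (Scheme.Γ.{u} ⋙ forget CommRingCat.{u}).IsRepresentable :=
    gammaRepresentableBy.isRepresentable
  exact GrothendieckTopology.Subcanonical.isSheaf_of_isRepresentable _

lemma isSheaf_gamma_over (X : Scheme.{u}) : Presieve.IsSheaf (flTop X)
    ((Over.forget X).op ⋙ Scheme.Γ.{u} ⋙ forget CommRingCat.{u}) :=
  (Over.forget X).op_comp_isSheaf_of_isSheaf_type (flTop X) isSheaf_gamma

variable (k : Type u) [Field k] (R : Type u) [CommRing R] [Algebra k R]

/-- The scheme `X = Spec R`. -/
abbrev specX : Scheme.{u} := Spec (CommRingCat.of R)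

/-- The structure morphism `k → R → Γ(T, 𝒪_T)` of a scheme `T` over `Spec R`. -/
def structureMap (T : Over (specX R)) : k →+* Γ(T.left, ⊤) :=
  (T.hom.appTop.hom.comp (Scheme.ΓSpecIso (CommRingCat.of R)).inv.hom).comp (algebraMap k R)

lemma structureMap_comp {T T' : Over (specX R)} (f : T ⟶ T') :
    f.left.appTop.hom.comp (structureMap k R T') = structureMap k R T := by
  unfold structureMap
  rw [← Over.w f, Scheme.Hom.comp_appTop]
  rfl

/-- The `k`-algebra `Γ(T, 𝒪_T)` of a scheme `T` over `Spec R`. -/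
def Functions (T : Over (specX R)) : Type u := Γ(T.left, ⊤)

instance (T : Over (specX R)) : CommRing (Functions R T) :=
  inferInstanceAs (CommRing Γ(T.left, ⊤))

instance (T : Over (specX R)) : Algebra k (Functions R T) := (structureMap k R T).toAlgebra

variable {R} in
/-- The pullback of functions along a morphism of schemes over `Spec R`. -/
def Functions.map {T T' : Over (specX R)} (f : T ⟶ T') : Functions R T' →ₐ[k] Functions R T where
  __ := (f.left.appTop.hom : Γ(T'.left, ⊤) →+* Γ(T.left, ⊤))
  commutes' a := RingHom.congr_fun (structureMap_comp k R f) a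

lemma Functions.map_id (T : Over (specX R)) : Functions.map k (𝟙 T) = AlgHom.id k _ := by
  apply AlgHom.ext
  intro x
  change (Scheme.Hom.appTop (𝟙 T.left)).hom x = x
  rw [Scheme.Hom.id_appTop]
  rfl

variable {R} in
lemma Functions.map_comp {T T' T'' : Over (specX R)} (f : T ⟶ T') (g : T' ⟶ T'') :
    Functions.map k (f ≫ g) = (Functions.map k f).comp (Functions.map k g) := by
  apply AlgHom.ext
  intro x
  change (Scheme.Hom.appTop (f.left ≫ g.left)).hom x = _
  rw [Scheme.Hom.comp_appTop]
  rfl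

/-- The functor `T ↦ Γ(T, 𝒪_T)` on schemes over `Spec R`, with values in `k`-algebras. -/
def structureFunctor : (Over (specX R))ᵒᵖ ⥤ CommAlgCat.{u} k where
  obj T := CommAlgCat.of k (Functions R T.unop)
  map f := CommAlgCat.ofHom (Functions.map k f.unop)
  map_id T := congrArg CommAlgCat.ofHom (Functions.map_id k R T.unop)
  map_comp f g := congrArg CommAlgCat.ofHom (Functions.map_comp k g.unop f.unop)

end StructureSheaf

section ModuleSheaf

variable {p : ℕ} [Fact p.Prime] {k : Type u} [Field k] [CharP k p]
variable {C : Type (u + 1)} [Category.{u} C] {J : GrothendieckTopology C}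

lemma isSheaf_frobKer (P : Cᵒᵖ ⥤ ModuleCat.{u} (DieudonneRing p k)) (m : ℕ)
    (hP : Presieve.IsSheaf J (P ⋙ forget _)) :
    Presieve.IsSheaf J ((P ⋙ frobKerFunctor p k m) ⋙ forget _) := by
  intro T S hS x hx
  let y : Presieve.FamilyOfElements (P ⋙ forget _) S.arrows := fun Y f hf => (x f hf).1
  have hy : y.Compatible := fun Y₁ Y₂ Z g₁ g₂ f₁ f₂ h₁ h₂ h =>
    congrArg Subtype.val (hx g₁ g₂ h₁ h₂ h)
  obtain ⟨t, ht, hu⟩ := hP S hS y hy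
  have key : DieudonneRing.F p k ^ m • (show P.obj (Opposite.op T) from t) = 0 := by
    apply (hP.isSeparated S hS).ext
    intro Y f hf
    have h1 : P.map f.op (DieudonneRing.F p k ^ m • (show P.obj (Opposite.op T) from t)) = 0 := by
      rw [map_smul]
      have := ht f hf
      change P.map f.op t = (x f hf).1 at this
      rw [this]
      exact (x f hf).2
    exact h1.trans (map_zero (P.map f.op).hom).symm
  refine ⟨⟨t, key⟩, fun Y f hf => Subtype.ext (ht f hf), fun t' ht' => Subtype.ext ?_⟩
  exact hu t'.1 fun Y f hf => congrArg Subtype.val (ht' f hf)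

/-- A sheaf of abelian groups with a left action of the Dieudonné ring. -/
structure DSheaf (p : ℕ) [Fact p.Prime] (k : Type u) [Field k] [CharP k p] {C : Type*}
    [Category* C] (J : GrothendieckTopology C) where
  /-- the sheaf of abelian groups -/
  sheaf : Sheaf J AddCommGrpCat.{u + 1}
  /-- the action on it -/
  action : DieudonneRing p k →+* End sheaf

/-- Multiplication by an element of the Dieudonné ring on a `𝔻`-module. -/
def moduleAction (M : ModuleCat.{u} (DieudonneRing p k)) (d : DieudonneRing p k) :
    (forget₂ (ModuleCat.{u} (DieudonneRing p k)) AddCommGrpCat.{u}).obj M ⟶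
      (forget₂ (ModuleCat.{u} (DieudonneRing p k)) AddCommGrpCat.{u}).obj M :=
  let f : M →+ M := DistribSMul.toAddMonoidHom M d
  AddCommGrpCat.ofHom f

/-- The action of the Dieudonné ring on a presheaf of `𝔻`-modules, regarded as a presheaf of
abelian groups. -/
def presheafAction (P : Cᵒᵖ ⥤ ModuleCat.{u} (DieudonneRing p k)) :
    DieudonneRing p k →+* End (P ⋙ forget₂ (ModuleCat.{u} (DieudonneRing p k)) AddCommGrpCat.{u} ⋙
      AddCommGrpCat.uliftFunctor.{u + 1}) where
  toFun d :=
    { app := fun T => AddCommGrpCat.uliftFunctor.{u + 1}.map (moduleAction (P.obj T) d)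
      naturality := fun T T' f => by
        apply AddCommGrpCat.hom_ext
        apply AddMonoidHom.ext
        intro x
        exact congrArg ULift.up ((map_smul (P.map f).hom d (show P.obj T from x.down)).symm) }
  map_one' := by
    apply NatTrans.ext
    funext T
    apply AddCommGrpCat.hom_ext
    apply AddMonoidHom.ext
    intro x
    exact congrArg ULift.up (one_smul (DieudonneRing p k) (show P.obj T from x.down))
  map_zero' := by
    apply NatTrans.ext
    funext T
    apply AddCommGrpCat.hom_ext
    apply AddMonoidHom.ext
    intro x
    exact congrArg ULift.up (zero_smul (DieudonneRing p k) (show P.obj T from x.down))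
  map_mul' a b := by
    apply NatTrans.ext
    funext T
    apply AddCommGrpCat.hom_ext
    apply AddMonoidHom.ext
    intro x
    exact congrArg ULift.up (mul_smul a b (show P.obj T from x.down))
  map_add' a b := by
    apply NatTrans.ext
    funext T
    apply AddCommGrpCat.hom_ext
    apply AddMonoidHom.ext
    intro x
    exact congrArg ULift.up (add_smul a b (show P.obj T from x.down))

/-- A presheaf of `𝔻`-modules that is a sheaf, regarded as a sheaf of abelian groups (in the next
universe) with an action of `𝔻`. -/
def DSheaf.ofPresheaf (P : Cᵒᵖ ⥤ ModuleCat.{u} (DieudonneRing p k))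
    (hP : Presieve.IsSheaf J (P ⋙ forget _)) : DSheaf p k J where
  sheaf := ⟨P ⋙ forget₂ (ModuleCat.{u} (DieudonneRing p k)) AddCommGrpCat.{u} ⋙
      AddCommGrpCat.uliftFunctor.{u + 1}, by
    have h : Presheaf.IsSheaf J
        (P ⋙ forget₂ (ModuleCat.{u} (DieudonneRing p k)) AddCommGrpCat.{u}) := by
      apply Presheaf.isSheaf_of_isSheaf_comp _ _ (forget AddCommGrpCat.{u})
      exact (isSheaf_iff_isSheaf_of_type _ _).mpr hP
    exact ((sheafCompose J AddCommGrpCat.uliftFunctor.{u + 1}).obj ⟨_, h⟩).property⟩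
  action :=
    { toFun := fun d => ⟨presheafAction P d⟩
      map_one' := by rw [map_one]; rfl
      map_zero' := by rw [map_zero]; rfl
      map_mul' := fun a b => by rw [map_mul]; rfl
      map_add' := fun a b => by rw [map_add]; rfl }

/-- The image of a sheaf with an action of `𝔻` under an additive functor. -/
def DSheaf.map {C' : Type*} [Category* C'] {C'' : Type*} [Category* C'']
    {J' : GrothendieckTopology C'} {J'' : GrothendieckTopology C''}
    [HasSheafify J' AddCommGrpCat.{u + 1}] [HasSheafify J'' AddCommGrpCat.{u + 1}]
    (Φ : Sheaf J' AddCommGrpCat.{u + 1} ⥤ Sheaf J'' AddCommGrpCat.{u + 1}) [Φ.Additive]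
    (G : DSheaf p k J') : DSheaf p k J'' where
  sheaf := Φ.obj G.sheaf
  action :=
    { toFun := fun d => Φ.map (G.action d)
      map_one' := by rw [map_one]; exact Φ.map_id _
      map_zero' := by rw [map_zero]; exact Φ.map_zero _ _
      map_mul' := fun a b => by rw [map_mul]; exact Φ.map_comp _ _
      map_add' := fun a b => by rw [map_add]; exact Φ.map_add }

end ModuleSheaf

section WittSheaf

variable (p : ℕ) [Fact p.Prime] (k : Type u) [Field k] [CharP k p] [PerfectRing k p]
variable (R : Type u) [CommRing R] [Algebra k R]

variable {R} in
lemma coeff_map_functions {n : ℕ} {T T' : Over (specX R)} (f : T ⟶ T')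
    (x : WittModule p k n (Functions R T')) (i : Fin n) :
    TruncatedWittVector.coeff (p := p) i (WittModule.map p n (Functions.map k f) x) =
      Functions.map k f (TruncatedWittVector.coeff (p := p) i x) :=
  coeff_wittMap (p := p) (Functions.map k f : Functions R T' →+* Functions R T) x i

lemma isSheaf_witt (n : ℕ) : Presieve.IsSheaf (flTop (specX R))
    ((structureFunctor k R ⋙ wittFunctor p k n) ⋙ forget _) := by
  intro T S hS x hx
  have h := isSheaf_gamma_over (specX R) S hS
  let y (i : Fin n) : Presieve.FamilyOfElements
      ((Over.forget (specX R)).op ⋙ Scheme.Γ.{u} ⋙ forget CommRingCat.{u}) S.arrows :=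
    fun Y f hf => TruncatedWittVector.coeff (p := p) i (x f hf)
  have hy (i : Fin n) : (y i).Compatible := fun Y₁ Y₂ Z g₁ g₂ f₁ f₂ h₁ h₂ hh => by
    have := congrArg (TruncatedWittVector.coeff (p := p) i) (hx g₁ g₂ h₁ h₂ hh)
    exact ((coeff_map_functions p k g₁ (x f₁ h₁) i).symm.trans this).trans
      (coeff_map_functions p k g₂ (x f₂ h₂) i)
  choose t ht hu using fun i => h (y i) (hy i)
  refine ⟨TruncatedWittVector.mk p (R := Functions R T) t, fun Y f hf => ?_, fun t' ht' => ?_⟩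
  · apply TruncatedWittVector.ext
    intro i
    refine (coeff_map_functions p k f _ i).trans ?_
    exact (congrArg _ (TruncatedWittVector.coeff_mk (p := p) (R := Functions R T) t i)).trans
      (ht i f hf)
  · apply TruncatedWittVector.ext
    intro i
    refine Eq.trans ?_ (TruncatedWittVector.coeff_mk (p := p) (R := Functions R T) t i).symm
    refine hu i _ fun Y f hf => ?_
    have := congrArg (TruncatedWittVector.coeff (p := p) i) (ht' f hf)
    exact (coeff_map_functions p k f t' i).symm.trans this

/-- The group scheme `𝐖_n` of Witt vectors of length `n`, as a sheaf on the big fppf site of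
`X = Spec R`: its sections over `T` are `W_n(Γ(T, 𝒪_T))`. -/
def wittSheaf (n : ℕ) : DSheaf p k (flTop (specX R)) :=
  .ofPresheaf (structureFunctor k R ⋙ wittFunctor p k n) (isSheaf_witt p k R n)

/-- The group scheme `𝐋_{n,m} = 𝐖_n[F^m]`, as a sheaf on the big fppf site of `X = Spec R`:
its sections over `T` are the kernel of `F^m` on `W_n(Γ(T, 𝒪_T))`. -/
def lSheaf (n m : ℕ) : DSheaf p k (flTop (specX R)) :=
  .ofPresheaf ((structureFunctor k R ⋙ wittFunctor p k n) ⋙ frobKerFunctor p k m)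
    (isSheaf_frobKer _ m (isSheaf_witt p k R n))

/-- The inclusion `𝐋_{n,m} → 𝐖_n`. -/
def lInclusion (n m : ℕ) : (lSheaf p k R n m).sheaf ⟶ (wittSheaf p k R n).sheaf :=
  ⟨Functor.whiskerRight (Functor.whiskerLeft (structureFunctor k R ⋙ wittFunctor p k n)
    (frobKerι p k m)) (forget₂ (ModuleCat.{u} (DieudonneRing p k)) AddCommGrpCat.{u} ⋙
      AddCommGrpCat.uliftFunctor.{u + 1})⟩

/-- The sheaf `W_n 𝒪_X` on the small Zariski site of `X = Spec R`: its sections over an open subset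
`U` are `W_n(Γ(U, 𝒪_U))`. -/
def wittSheafZar (n : ℕ) : DSheaf p k (zarTop (specX R)) :=
  (wittSheaf p k R n).map (toZar (specX R))

end WittSheaf

/-! ### Cohomology -/

section Cohomology

open Abelian Opposite

variable {C : Type*} [Category.{u} C] (J : GrothendieckTopology C)
  [HasSheafify J AddCommGrpCat.{u + 1}]

/-- The functor that sends an object `T` of a site to the sheaf `ℤ_T` associated with the presheaf
of free abelian groups on `Hom(-, T)`. Homomorphisms from `ℤ_T` to a sheaf of abelian groups `G` are
sections of `G` over `T`, so that the cohomology groups `Hⁱ(T, G)` are the groups `Extⁱ(ℤ_T, G)`. -/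
def freeSheaf : C ⥤ Sheaf J AddCommGrpCat.{u + 1} :=
  uliftYoneda.{u + 1} ⋙ (Functor.whiskeringRight _ _ _).obj AddCommGrpCat.free.{u + 1} ⋙
    presheafToSheaf J AddCommGrpCat.{u + 1}

variable {J}

/-- The homomorphism `ℤ_T → G` that corresponds to a section of `G` over `T`. -/
def freeSheafDesc {T : C} {G : Sheaf J AddCommGrpCat.{u + 1}} (s : G.obj.obj (op T)) :
    (freeSheaf J).obj T ⟶ G :=
  ((sheafificationAdjunction J AddCommGrpCat.{u + 1}).homEquiv _ _).symm
    (((AddCommGrpCat.adj.{u + 1}.whiskerRight Cᵒᵖ).homEquiv _ _).symm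
      (uliftYonedaEquiv.{u + 1}.symm s))

variable (J) in
/-- The canonical section of `ℤ_T` over `T`. -/
def freeSheafSection (T : C) : ((freeSheaf J).obj T).obj.obj (op T) :=
  (toSheafify J (uliftYoneda.{u + 1}.obj T ⋙ AddCommGrpCat.free.{u + 1})).app (op T)
    (FreeAbelianGroup.of (ULift.up (𝟙 T)))

instance mono_freeSheaf_map {T T' : C} (f : T ⟶ T') [Mono f] : Mono ((freeSheaf J).map f) := by
  have h1 : Mono (uliftYoneda.{u + 1}.map f) := by
    have (Y : Cᵒᵖ) : Mono ((uliftYoneda.{u + 1}.map f).app Y) := by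
      rw [mono_iff_injective]
      intro a b hab
      have h := congrArg ULift.down hab
      exact ULift.ext _ _ ((cancel_mono f).mp h)
    exact NatTrans.mono_of_mono_app _
  have h2 : Mono (((Functor.whiskeringRight _ _ _).obj AddCommGrpCat.free.{u + 1}).map
      (uliftYoneda.{u + 1}.map f)) := by
    have (Y : Cᵒᵖ) : Mono ((((Functor.whiskeringRight _ _ _).obj AddCommGrpCat.free.{u + 1}).map
        (uliftYoneda.{u + 1}.map f)).app Y) :=
      inferInstanceAs (Mono (AddCommGrpCat.free.{u + 1}.map ((uliftYoneda.{u + 1}.map f).app Y)))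
    exact NatTrans.mono_of_mono_app _
  exact inferInstanceAs (Mono ((presheafToSheaf J AddCommGrpCat.{u + 1}).map
    (((Functor.whiskeringRight _ _ _).obj AddCommGrpCat.free.{u + 1}).map
      (uliftYoneda.{u + 1}.map f))))

variable {p : ℕ} [Fact p.Prime] {k : Type u} [Field k] [CharP k p]
  [HasExt.{u + 1} (Sheaf J AddCommGrpCat.{u + 1})]

/-- The group `Extⁱ(P, G)` for a sheaf `G` with an action of the Dieudonné ring, as a left
`𝔻`-module by functoriality in `G`. -/
def DExt (P : Sheaf J AddCommGrpCat.{u + 1}) (G : DSheaf p k J) (i : ℕ) : Type (u + 1) :=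
  Ext.{u + 1} P G.sheaf i

instance (P : Sheaf J AddCommGrpCat.{u + 1}) (G : DSheaf p k J) (i : ℕ) :
    AddCommGroup (DExt P G i) :=
  inferInstanceAs (AddCommGroup (Ext.{u + 1} P G.sheaf i))

/-- The action of the Dieudonné ring on `Extⁱ(P, G)`. -/
def extAction (P : Sheaf J AddCommGrpCat.{u + 1}) (G : DSheaf p k J) (i : ℕ) :
    DieudonneRing p k →+* AddMonoid.End (Ext.{u + 1} P G.sheaf i) where
  toFun d := (Ext.mk₀ (G.action d)).postcomp P (add_zero i)
  map_one' := by
    rw [map_one]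
    apply AddMonoidHom.ext
    intro x
    exact Ext.comp_mk₀_id x
  map_zero' := by
    rw [map_zero]
    apply AddMonoidHom.ext
    intro x
    change x.comp (Ext.mk₀ 0) (add_zero i) = 0
    simp
  map_mul' a b := by
    rw [map_mul]
    apply AddMonoidHom.ext
    intro x
    change x.comp (Ext.mk₀ (G.action b ≫ G.action a)) (add_zero i) =
      (x.comp (Ext.mk₀ (G.action b)) (add_zero i)).comp (Ext.mk₀ (G.action a)) (add_zero i)
    rw [← Ext.mk₀_comp_mk₀, Ext.comp_assoc]
    all_goals simp
  map_add' a b := by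
    rw [map_add]
    apply AddMonoidHom.ext
    intro x
    change x.comp (Ext.mk₀ (G.action a + G.action b)) (add_zero i) =
      x.comp (Ext.mk₀ (G.action a)) (add_zero i) + x.comp (Ext.mk₀ (G.action b)) (add_zero i)
    rw [Ext.mk₀_add, Ext.comp_add]

instance (P : Sheaf J AddCommGrpCat.{u + 1}) (G : DSheaf p k J) (i : ℕ) :
    Module (DieudonneRing p k) (DExt P G i) :=
  Module.compHom (Ext.{u + 1} P G.sheaf i) (extAction P G i)

/-- The `𝔻`-linear map `Extⁱ(P, G) → Extⁱ(P', G)` induced by a homomorphism `P' → P`. -/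
def DExt.precomp {P P' : Sheaf J AddCommGrpCat.{u + 1}} (f : P' ⟶ P) (G : DSheaf p k J) (i : ℕ) :
    DExt P G i →ₗ[DieudonneRing p k] DExt P' G i where
  toFun x := (Ext.mk₀ f).comp (show Ext.{u + 1} P G.sheaf i from x) (zero_add i)
  map_add' x y := Ext.comp_add _ _ _ _
  map_smul' d x := by
    exact (Ext.comp_assoc (Ext.mk₀ f) (show Ext.{u + 1} P G.sheaf i from x)
      (Ext.mk₀ (G.action d)) (zero_add i) (add_zero i) (by omega)).symm

/-- The connecting homomorphism `Extⁱ(P₁, G) → Extⁱ⁺¹(P₃, G)` of a short exact sequence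
`0 → P₁ → P₂ → P₃ → 0`. -/
def DExt.connecting {S : ShortComplex (Sheaf J AddCommGrpCat.{u + 1})} (hS : S.ShortExact)
    (G : DSheaf p k J) (i : ℕ) : DExt S.X₁ G i →ₗ[DieudonneRing p k] DExt S.X₃ G (i + 1) where
  toFun x := hS.extClass.comp (show Ext.{u + 1} S.X₁ G.sheaf i from x) (add_comm 1 i)
  map_add' x y := Ext.comp_add _ _ _ _
  map_smul' d x := by
    exact (Ext.comp_assoc hS.extClass (show Ext.{u + 1} S.X₁ G.sheaf i from x)
      (Ext.mk₀ (G.action d)) (add_comm 1 i) (add_zero i) (by omega)).symm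

end Cohomology

section Comparison

open Abelian Opposite

variable (X : Scheme.{u})

/-- The canonical homomorphism from the fppf sheaf `ℤ_U` to the inverse image of the Zariski sheaf
`ℤ_U`, for an open subset `U` of `X`. -/
def freeSheafToInverseImage (U : X.Opens) :
    (freeSheaf (flTop X)).obj (X.restrictFunctor.obj U) ⟶
      (fromZar X).obj ((freeSheaf (zarTop X)).obj U) :=
  freeSheafDesc (((zarAdj X).unit.app ((freeSheaf (zarTop X)).obj U)).hom.app (op U)
    (freeSheafSection (zarTop X) U))

/-- The canonical comparison homomorphism `Hⁱ_Zar(U, G) → Hⁱ_fl(U, G)` from Zariski to flat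
cohomology, for an open subset `U` of `X` and a sheaf `G` on the big fppf site of `X`. -/
def zarToFlat (U : X.Opens) (G : Sheaf (flTop X) AddCommGrpCat.{u + 1}) (i : ℕ)
    (x : Ext.{u + 1} ((freeSheaf (zarTop X)).obj U) ((toZar X).obj G) i) :
    Ext.{u + 1} ((freeSheaf (flTop X)).obj (X.restrictFunctor.obj U)) G i :=
  ((Ext.mk₀ (freeSheafToInverseImage X U)).comp (x.mapExactFunctor (fromZar X)) (zero_add i)).comp
    (Ext.mk₀ ((zarAdj X).counit.app G)) (add_zero i)

end Comparison

/-! ### Singularities and their local torsors -/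

section Singularity

/-- Serre's condition `S₂` for a Noetherian ring `R`: for every prime ideal `P`, the local ring
`R_P` has depth at least `min(2, dim R_P)`, that is, its maximal ideal contains a regular sequence
of every length `i ≤ min(2, dim R_P)`. -/
def SerreS2 (R : Type u) [CommRing R] : Prop :=
  ∀ (P : Ideal R) [P.IsPrime] (i : ℕ), i ≤ 2 →
    (i : WithBot ℕ∞) ≤ ringKrullDim (Localization.AtPrime P) →
      ∃ rs : List (Localization.AtPrime P), rs.length = i ∧
      (∀ r ∈ rs, r ∈ IsLocalRing.maximalIdeal (Localization.AtPrime P)) ∧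
        RingTheory.Sequence.IsRegular (Localization.AtPrime P) rs

/-- A singularity: an integral, complete, Noetherian local ring of dimension at least two that
satisfies Serre's condition `S₂`. -/
structure IsSingularity (R : Type u) [CommRing R] [IsLocalRing R] : Prop where
  isDomain : IsDomain R
  isNoetherianRing : IsNoetherianRing R
  isAdicComplete : IsAdicComplete (IsLocalRing.maximalIdeal R) R
  two_le_dim : 2 ≤ ringKrullDim R
  serreS2 : SerreS2 R

variable (R : Type u) [CommRing R] [IsLocalRing R]

/-- The punctured spectrum `U = X ∖ {x}`, where `x` is the closed point of `X = Spec R`. -/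
def puncturedSpec : (specX R).Opens :=
  ⟨{IsLocalRing.closedPoint R}ᶜ, (IsLocalRing.isClosed_singleton_closedPoint R).isOpen_compl⟩

end Singularity

section LocalTorsors

open Abelian

variable (p : ℕ) [Fact p.Prime] (k : Type u) [Field k] [CharP k p] [PerfectRing k p]
variable (R : Type u) [CommRing R] [Algebra k R]

/-- The flat cohomology group `H¹_fl(X, 𝐋_{n,m})`. -/
abbrev flatH1X (n m : ℕ) : Type (u + 1) :=
  DExt ((freeSheaf (flTop (specX R))).obj (Over.mk (𝟙 (specX R)))) (lSheaf p k R n m) 1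

variable {R} in
/-- The flat cohomology group `H¹_fl(U, 𝐋_{n,m})` of an open subset `U` of `X`. -/
abbrev flatH1 (U : (specX R).Opens) (n m : ℕ) : Type (u + 1) :=
  DExt ((freeSheaf (flTop (specX R))).obj ((specX R).restrictFunctor.obj U)) (lSheaf p k R n m) 1

variable {R} in
/-- The inclusion of an open subset `U` of `X`, as a morphism of `X`-schemes. -/
def openInclusion (U : (specX R).Opens) :
    (specX R).restrictFunctor.obj U ⟶ Over.mk (𝟙 (specX R)) :=
  Over.mkIdTerminal.from _

variable {R} in
/-- The restriction `H¹_fl(X, 𝐋_{n,m}) → H¹_fl(U, 𝐋_{n,m})`. -/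
def flatRestriction (U : (specX R).Opens) (n m : ℕ) :
    flatH1X p k R n m →ₗ[DieudonneRing p k] flatH1 p k U n m :=
  DExt.precomp ((freeSheaf (flTop (specX R))).map (openInclusion U)) (lSheaf p k R n m) 1

variable {R} in
/-- The homomorphism `H¹_fl(U, 𝐋_{n,m}) → H¹_fl(U, 𝐖_n)` induced by the inclusion
`𝐋_{n,m} → 𝐖_n`. -/
def flatInclusion (U : (specX R).Opens) (n m : ℕ) (ξ : flatH1 p k U n m) :
    Ext.{u + 1} ((freeSheaf (flTop (specX R))).obj ((specX R).restrictFunctor.obj U))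
      (wittSheaf p k R n).sheaf 1 :=
  Ext.comp (show Ext.{u + 1} _ (lSheaf p k R n m).sheaf 1 from ξ) (Ext.mk₀ (lInclusion p k R n m))
    (add_zero 1)

variable {R} in
/-- The Zariski cohomology group `H¹(U, W_n 𝒪_U)` of an open subset `U` of `X`. -/
abbrev zarH1 (U : (specX R).Opens) (n : ℕ) : Type (u + 1) :=
  DExt ((freeSheaf (zarTop (specX R))).obj U) (wittSheafZar p k R n) 1

variable {R} in
/-- The canonical homomorphism `H¹(U, W_n 𝒪_U) → H¹_fl(U, 𝐖_n)`. -/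
def wittZarToFlat (U : (specX R).Opens) (n : ℕ) (z : zarH1 p k U n) :
    Ext.{u + 1} ((freeSheaf (flTop (specX R))).obj ((specX R).restrictFunctor.obj U))
      (wittSheaf p k R n).sheaf 1 :=
  zarToFlat (specX R) U (wittSheaf p k R n).sheaf 1 z

/-- The sequence `0 → ℤ_U → ℤ_X → ℤ_X/ℤ_U → 0` of sheaves on the small Zariski site of `X`, for an
open subset `U` of `X`. Homomorphisms from `ℤ_X/ℤ_U` to a sheaf `G` are the sections of `G` over `X`
with support in the complement of `U`. -/
def supportSequence {X : Scheme.{u}} (U : X.Opens) :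
    ShortComplex (Sheaf (zarTop X) AddCommGrpCat.{u + 1}) :=
  ShortComplex.mk ((freeSheaf (zarTop X)).map (homOfLE (le_top : U ≤ ⊤)))
    (cokernel.π ((freeSheaf (zarTop X)).map (homOfLE (le_top : U ≤ ⊤)))) (cokernel.condition _)

lemma supportSequence_shortExact {X : Scheme.{u}} (U : X.Opens) :
    (supportSequence U).ShortExact where
  exact := ShortComplex.exact_cokernel _
  mono_f := inferInstanceAs (Mono ((freeSheaf (zarTop X)).map (homOfLE (le_top : U ≤ ⊤))))
  epi_g := coequalizer.π_epi

variable [IsLocalRing R]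

/-- The local cohomology group `H²_𝔪(X, W_n 𝒪_X)`: the second derived functor of the functor of
sections with support in the closed point, applied to `W_n 𝒪_X`. -/
abbrev localH2 (n : ℕ) : Type (u + 1) :=
  DExt (supportSequence (puncturedSpec R)).X₃ (wittSheafZar p k R n) 2

/-- The connecting homomorphism `H¹(U, W_n 𝒪_U) → H²_𝔪(X, W_n 𝒪_X)` of local cohomology. -/
def localConnecting (n : ℕ) :
    zarH1 p k (puncturedSpec R) n →ₗ[DieudonneRing p k] localH2 p k R n :=
  DExt.connecting (supportSequence_shortExact (puncturedSpec R)) (wittSheafZar p k R n) 1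

/-- The `𝔻`-module of equivalence classes of local `𝐋_{n,m}`-torsors: the quotient of
`H¹_fl(U, 𝐋_{n,m})` by the image of `H¹_fl(X, 𝐋_{n,m})`. -/
abbrev LocalTorsorClasses (n m : ℕ) : Type (u + 1) :=
  flatH1 p k (puncturedSpec R) n m ⧸
    LinearMap.range (flatRestriction p k (puncturedSpec R) n m)

end LocalTorsors

end LocalTorsor

end

open LocalTorsor

/-! The `m`-th power of the Frobenius is an fppf epimorphism of `𝐖_n`, because raising coordinates
to the power `p ^ m` can be inverted after a finite free covering. So `0 → 𝐋_{n,m} → 𝐖_n → 𝐖_n → 0`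
is exact (`frobSequence_shortExact`), and its long exact sequence over `U` shows that the image of
`H¹_fl(U, 𝐋_{n,m})` in `H¹_fl(U, 𝐖_n)` is the kernel of `F^m`, while the classes that die there are
the connecting images of sections of `𝐖_n` over `U`.

These are exactly the classes that come from `X`. On the one hand, depth at least two at the closed
point makes every function on `U` extend to `X` (`surjective_functions_map_openInclusion`), hence
every Witt vector over `U` extends coordinate by coordinate, and connecting homomorphisms commute
with restriction. On the other hand, `X` is affine, so `H¹_fl(X, 𝐖_n) = 0` and every class from `X`
dies. This is `ker_flatInclusionLinear`; the cokernel in question is therefore `H¹_fl(U, 𝐖_n)[F^m]`.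

It remains to identify `H¹_fl(U, 𝐖_n)` with `H²_𝔪(X, W_n 𝒪_X)`. Faithfully flat descent for Witt
vectors (`exists_of_witt_cocycle`) is deduced from the additive case by dévissage along `0 → 𝔾_a →
𝐖_{n+1} → 𝐖_n → 0`. It implies that for an extension of sheaves with kernel `𝐖_n` sections lift over
affine schemes, whence flat and Zariski `H¹` agree (`zarToFlat_bijective`). Finally `X` is local, so
taking sections over `X` is exact on Zariski sheaves, the higher Zariski cohomology of `X` vanishes,
and the connecting homomorphism `H¹(U) → H²_𝔪(X)` is bijective (`localConnecting_bijective`).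

All maps involved are `𝔻`-linear. Uniqueness follows from the injectivity of the comparison map: the
Zariski class `z` attached to `ξ` is forced. -/

noncomputable section

namespace LocalTorsor

/-! ### Exactness of the Amitsur complex in degree one -/

section Amitsur

open scoped TensorProduct
open Algebra.TensorProduct (includeLeft includeRight)

variable (A B : Type u) [CommRing A] [CommRing B] [Algebra A B]

/-- The coface map `x ⊗ y ↦ 1 ⊗ x ⊗ y`. -/
abbrev coface₀ : B ⊗[A] B →ₐ[A] B ⊗[A] (B ⊗[A] B) := includeRight

/-- The coface map `x ⊗ y ↦ x ⊗ 1 ⊗ y`. -/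
abbrev coface₁ : B ⊗[A] B →ₐ[A] B ⊗[A] (B ⊗[A] B) :=
  Algebra.TensorProduct.map (AlgHom.id A B) includeRight

/-- The coface map `x ⊗ y ↦ x ⊗ y ⊗ 1`. -/
abbrev coface₂ : B ⊗[A] B →ₐ[A] B ⊗[A] (B ⊗[A] B) :=
  Algebra.TensorProduct.map (AlgHom.id A B) includeLeft

/-- Faithful flatness allows exactness to be checked after tensoring with `B`, where the complex
acquires a contracting homotopy. -/
lemma amitsur_exact [Module.FaithfullyFlat A B] :
    Function.Exact ((includeRight : B →ₐ[A] B ⊗[A] B).toLinearMap -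
        (includeLeft : B →ₐ[A] B ⊗[A] B).toLinearMap)
      ((coface₀ A B).toLinearMap - (coface₁ A B).toLinearMap + (coface₂ A B).toLinearMap) := by
  set d₀ := (includeRight : B →ₐ[A] B ⊗[A] B).toLinearMap -
    (includeLeft : B →ₐ[A] B ⊗[A] B).toLinearMap with hd₀
  set d₁ := (coface₀ A B).toLinearMap - (coface₁ A B).toLinearMap +
    (coface₂ A B).toLinearMap with hd₁
  apply Module.FaithfullyFlat.lTensor_reflects_exact A B
  -- The homotopy multiplies the new factor `B` into the first old one; `key` is the homotopy
  -- identity in degree one.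
  let h (M : Type u) [AddCommGroup M] [Module A M] : B ⊗[A] (B ⊗[A] M) →ₗ[A] B ⊗[A] M :=
    (LinearMap.rTensor M (LinearMap.mul' A B)) ∘ₗ (TensorProduct.assoc A B B M).symm.toLinearMap
  have key : h (B ⊗[A] B) ∘ₗ d₁.lTensor B = LinearMap.id - d₀.lTensor B ∘ₗ h B := by
    ext b x y
    simp [h, hd₀, hd₁]
    abel
  have hz : d₁ ∘ₗ d₀ = 0 := by
    ext b
    simp [hd₀, hd₁, TensorProduct.tmul_sub]
  intro c
  constructor
  · intro hc
    refine ⟨h B c, ?_⟩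
    have := LinearMap.congr_fun key c
    simp only [LinearMap.comp_apply, hc, map_zero, LinearMap.sub_apply, LinearMap.id_apply] at this
    exact (sub_eq_zero.mp this.symm).symm
  · rintro ⟨c, rfl⟩
    rw [← LinearMap.comp_apply, ← LinearMap.lTensor_comp, hz]
    simp

end Amitsur

/-! ### Descent of Witt vectors along faithfully flat algebras -/

section WittCocycle

open scoped TensorProduct
open Algebra.TensorProduct (includeLeft includeRight)

variable {p : ℕ} [Fact p.Prime]

/-- The additive map `a ↦ (0, …, 0, a)` from `A` to `W_{n+1}(A)`. -/
def wittTop (n : ℕ) (A : Type u) [CommRing A] : A →+ TruncatedWittVector p (n + 1) A :=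
  AddMonoidHom.mk' (fun a => WittVector.truncate (n + 1)
    (WittVector.verschiebung^[n] (WittVector.teichmuller p a))) fun a b => by
  -- The Teichmüller map is not additive, but after `n` shifts and truncation to length `n + 1` only
  -- the coefficient of index `0` survives, and that one is additive.
  rw [← map_add, ← iterate_map_add]
  ext i
  rw [WittVector.coeff_truncate, WittVector.coeff_truncate]
  rcases (Nat.lt_succ_iff_lt_or_eq.mp i.2) with h | h
  · rw [WittVector.iterate_verschiebung_coeff_eq_zero _ h,
      WittVector.iterate_verschiebung_coeff_eq_zero _ h]
  · have (x : WittVector p A) : (WittVector.verschiebung^[n] x).coeff i = x.coeff 0 := by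
      rw [h, ← WittVector.iterate_verschiebung_coeff x n 0, zero_add]
    rw [this, this]
    simp [WittVector.add_coeff_zero]

lemma coeff_wittTop_castSucc {n : ℕ} {A : Type u} [CommRing A] (a : A) (i : Fin n) :
    (wittTop (p := p) n A a).coeff i.castSucc = 0 := by
  change TruncatedWittVector.coeff _ (WittVector.truncate _ _) = _
  rw [WittVector.coeff_truncate]
  exact WittVector.iterate_verschiebung_coeff_eq_zero _ i.2

lemma coeff_wittTop_last {n : ℕ} {A : Type u} [CommRing A] (a : A) :
    (wittTop (p := p) n A a).coeff (Fin.last n) = a := by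
  change TruncatedWittVector.coeff _ (WittVector.truncate _ _) = _
  rw [WittVector.coeff_truncate]
  have := WittVector.iterate_verschiebung_coeff (WittVector.teichmuller p a) n 0
  simpa using this

lemma wittMap_wittTop {n : ℕ} {A B : Type u} [CommRing A] [CommRing B] (f : A →+* B) (a : A) :
    wittMap (n + 1) f (wittTop (p := p) n A a) = wittTop n B (f a) := by
  ext i
  induction i using Fin.lastCases with
  | last => simp [coeff_wittTop_last]
  | cast i => simp [coeff_wittTop_castSucc]

lemma wittMap_truncate_le {n : ℕ} {A B : Type u} [CommRing A] [CommRing B] (f : A →+* B)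
    (x : TruncatedWittVector p (n + 1) A) :
    TruncatedWittVector.truncate n.le_succ (wittMap (n + 1) f x) =
      wittMap n f (TruncatedWittVector.truncate n.le_succ x) := by
  ext i
  simp [TruncatedWittVector.coeff_truncate]

/-- Together with `coeff_wittTop_last` this identifies the kernel of `W_{n+1}(A) → W_n(A)` with the
additive group of `A`, which is the input for induction on the length. -/
lemma eq_wittTop_of_truncate_eq_zero {n : ℕ} {A : Type u} [CommRing A]
    (x : TruncatedWittVector p (n + 1) A) (hx : TruncatedWittVector.truncate n.le_succ x = 0) :
    x = wittTop n A (x.coeff (Fin.last n)) := by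
  ext i
  induction i using Fin.lastCases with
  | last => simp [coeff_wittTop_last]
  | cast i =>
    have := congrArg (TruncatedWittVector.coeff i) hx
    rw [TruncatedWittVector.coeff_truncate] at this
    rw [coeff_wittTop_castSucc]
    exact this.trans (TruncatedWittVector.coeff_zero _ _ _ _)

/-- A one-cocycle of the Amitsur complex of a faithfully flat algebra with values in Witt vectors
of finite length is a coboundary. -/
lemma exists_of_witt_cocycle (A B : Type u) [CommRing A] [CommRing B] [Algebra A B]
    [Module.FaithfullyFlat A B] (n : ℕ) (c : TruncatedWittVector p n (B ⊗[A] B))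
    (hc : wittMap n (coface₀ A B).toRingHom c - wittMap n (coface₁ A B).toRingHom c +
      wittMap n (coface₂ A B).toRingHom c = 0) :
    ∃ b : TruncatedWittVector p n B,
      c = wittMap n (includeRight : B →ₐ[A] B ⊗[A] B).toRingHom b -
        wittMap n (includeLeft : B →ₐ[A] B ⊗[A] B).toRingHom b := by
  -- Coboundaries are cocycles by the cosimplicial identities `e1`, `e2`, `e3`. This keeps the
  -- cocycle condition intact when `c` is corrected by a coboundary below.
  have hz {n : ℕ} (b : TruncatedWittVector p n B) (c : TruncatedWittVector p n (B ⊗[A] B))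
      (hc : c = wittMap n (includeRight : B →ₐ[A] B ⊗[A] B).toRingHom b -
        wittMap n (includeLeft : B →ₐ[A] B ⊗[A] B).toRingHom b) :
      wittMap n (coface₀ A B).toRingHom c - wittMap n (coface₁ A B).toRingHom c +
        wittMap n (coface₂ A B).toRingHom c = 0 := by
    have e1 : wittMap n (coface₀ A B).toRingHom
        (wittMap n (includeRight : B →ₐ[A] B ⊗[A] B).toRingHom b) =
        wittMap n (coface₁ A B).toRingHom
          (wittMap n (includeRight : B →ₐ[A] B ⊗[A] B).toRingHom b) := by
      ext i; simp
    have e2 : wittMap n (coface₀ A B).toRingHom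
        (wittMap n (includeLeft : B →ₐ[A] B ⊗[A] B).toRingHom b) =
        wittMap n (coface₂ A B).toRingHom
          (wittMap n (includeRight : B →ₐ[A] B ⊗[A] B).toRingHom b) := by
      ext i; simp
    have e3 : wittMap n (coface₁ A B).toRingHom
        (wittMap n (includeLeft : B →ₐ[A] B ⊗[A] B).toRingHom b) =
        wittMap n (coface₂ A B).toRingHom
          (wittMap n (includeLeft : B →ₐ[A] B ⊗[A] B).toRingHom b) := by
      ext i; simp
    rw [hc]
    simp only [map_sub, e1, e2, e3]
    abel
  induction n with
  | zero => exact ⟨0, TruncatedWittVector.ext fun i => i.elim0⟩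
  | succ n ih =>
    -- By induction the truncation of `c` bounds some `b'`. Any lift `b` of `b'` gives a coboundary
    -- `t` such that `c - t` lies in the additive kernel of truncation, where `amitsur_exact`
    -- applies.
    obtain ⟨b', hb'⟩ := ih (TruncatedWittVector.truncate n.le_succ c) (by
      rw [← wittMap_truncate_le, ← wittMap_truncate_le, ← wittMap_truncate_le, ← map_sub,
        ← map_add, hc, map_zero])
    obtain ⟨b, rfl⟩ := TruncatedWittVector.truncate_surjective n.le_succ b'
    set t := wittMap (n + 1) (includeRight : B →ₐ[A] B ⊗[A] B).toRingHom b -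
      wittMap (n + 1) (includeLeft : B →ₐ[A] B ⊗[A] B).toRingHom b with ht
    have h0 : TruncatedWittVector.truncate n.le_succ (c - t) = 0 := by
      rw [map_sub, ht, map_sub, wittMap_truncate_le, wittMap_truncate_le, hb', sub_self]
    have h1 := eq_wittTop_of_truncate_eq_zero _ h0
    set a := (c - t).coeff (Fin.last n)
    have hct : wittMap (n + 1) (coface₀ A B).toRingHom (c - t) -
        wittMap (n + 1) (coface₁ A B).toRingHom (c - t) +
        wittMap (n + 1) (coface₂ A B).toRingHom (c - t) = 0 := by
      have := congrArg₂ (· - ·) hc (hz b t ht)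
      simp only [sub_zero] at this
      rw [← this]
      simp only [map_sub]
      abel
    rw [h1, wittMap_wittTop, wittMap_wittTop, wittMap_wittTop, ← map_sub, ← map_add] at hct
    have ha := congrArg (TruncatedWittVector.coeff (Fin.last n)) hct
    rw [coeff_wittTop_last, TruncatedWittVector.coeff_zero] at ha
    obtain ⟨y, hy⟩ := (amitsur_exact A B a).mp ha
    refine ⟨b + wittTop n B y, ?_⟩
    rw [map_add, map_add, wittMap_wittTop, wittMap_wittTop, add_sub_add_comm, ← ht, ← map_sub]
    have hy' : (includeRight : B →ₐ[A] B ⊗[A] B).toRingHom y -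
      (includeLeft : B →ₐ[A] B ⊗[A] B).toRingHom y = a := hy
    rw [hy', ← h1]
    abel

end WittCocycle

/-! ### Extension of functions from the punctured spectrum -/

section Extension

/-- Serre's condition is needed at the maximal ideal only. There the localization is `R` itself,
since all elements outside the maximal ideal are units, and dimension at least two yields a regular
sequence `a, b`. The divisibility condition says that `b` is a nonzerodivisor modulo `a`. -/
lemma exists_regular_pair (R : Type u) [CommRing R] [IsLocalRing R] (hR : IsSingularity R) :
    ∃ a b : R, a ∈ IsLocalRing.maximalIdeal R ∧ b ∈ IsLocalRing.maximalIdeal R ∧ a ≠ 0 ∧ b ≠ 0 ∧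
      ∀ x, a ∣ b * x → a ∣ x := by
  have := hR.isDomain
  let P := IsLocalRing.maximalIdeal R
  let e : R ≃ₐ[R] Localization.AtPrime P :=
    IsLocalization.atUnits R P.primeCompl fun x hx => by
      have : ¬ x ∈ P := hx
      rw [IsLocalRing.mem_maximalIdeal, mem_nonunits_iff, not_not] at this
      exact this
  have hdim : (2 : ℕ) ≤ ringKrullDim (Localization.AtPrime P) := by
    rw [← ringKrullDim_eq_of_ringEquiv e.toRingEquiv]
    exact hR.two_le_dim
  obtain ⟨rs, hlen, hmem, hreg⟩ := hR.serreS2 P 2 le_rfl hdim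
  obtain ⟨a, b, rfl⟩ := List.length_eq_two.mp hlen
  rw [RingTheory.Sequence.isRegular_cons_iff, RingTheory.Sequence.isRegular_cons_iff] at hreg
  obtain ⟨ha, hb, -⟩ := hreg
  have hdvd (x : Localization.AtPrime P) (h : a ∣ b * x) : a ∣ x := by
    have h0 : (Submodule.Quotient.mk (b * x) : QuotSMulTop a (Localization.AtPrime P)) = 0 := by
      rw [Submodule.Quotient.mk_eq_zero]
      obtain ⟨y, hy⟩ := h
      rw [hy]
      exact Submodule.smul_mem_pointwise_smul y a ⊤ trivial
    have h1 : b • (Submodule.Quotient.mk x : QuotSMulTop a (Localization.AtPrime P)) = b • 0 := by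
      rw [smul_zero, ← Submodule.Quotient.mk_smul]
      exact h0
    have h2 := hb h1
    rw [Submodule.Quotient.mk_eq_zero] at h2
    obtain ⟨y, -, hy⟩ := h2
    exact ⟨y, hy.symm⟩
  have hm (x : Localization.AtPrime P) (hx : x ∈ IsLocalRing.maximalIdeal (Localization.AtPrime P)) :
      e.symm x ∈ IsLocalRing.maximalIdeal R := by
    rw [IsLocalRing.mem_maximalIdeal, mem_nonunits_iff] at hx ⊢
    rwa [MulEquiv.isUnit_map]
  -- If `a` were `0`, multiplication by `a` would not be injective; if `b` were `0`, the
  -- divisibility property would give `a ∣ 1`, although `a` is not a unit.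
  have ha0 : a ≠ 0 := by
    rintro rfl
    have : (1 : Localization.AtPrime P) = 0 := ha (by simp)
    exact one_ne_zero this
  have hb0 : b ≠ 0 := by
    rintro rfl
    have h1 : a ∣ 1 := hdvd 1 (by simp)
    exact (hmem a (by simp)) (isUnit_of_dvd_one h1)
  refine ⟨e.symm a, e.symm b, hm a (hmem a (by simp)), hm b (hmem b (by simp)),
    by simpa using ha0, by simpa using hb0, fun x h => ?_⟩
  obtain ⟨y, hy⟩ := h
  obtain ⟨z, hz⟩ := hdvd (e x) ⟨e y, by
    have := congrArg e hy
    simpa using this⟩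
  exact ⟨e.symm z, by
    have := congrArg e.symm hz
    simpa using this⟩

/-- Factors `b` are removed one at a time, which settles exponent one of `a`; then one factor `a` is
cancelled in the domain and induction on `i` continues. -/
lemma dvd_of_pow_dvd_pow_mul {R : Type u} [CommRing R] [IsDomain R] {a b : R} (ha : a ≠ 0)
    (h : ∀ x, a ∣ b * x → a ∣ x) (i j : ℕ) (x : R) (hx : a ^ i ∣ b ^ j * x) : a ^ i ∣ x := by
  have hj (j : ℕ) (x : R) (hx : a ∣ b ^ j * x) : a ∣ x := by
    induction j with
    | zero => simpa using hx
    | succ j ih => exact ih (h _ (by rwa [pow_succ', mul_assoc] at hx))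
  induction i generalizing x with
  | zero => simp
  | succ i ih =>
    obtain ⟨y, rfl⟩ := hj j x ((dvd_pow_self a i.succ_ne_zero).trans hx)
    rw [pow_succ']
    refine mul_dvd_mul_left a (ih y ?_)
    rw [pow_succ', mul_left_comm] at hx
    exact (mul_dvd_mul_iff_left ha).mp hx

/-- A section over `U` is a fraction `x / a ^ i` on `D(a)` and `y / b ^ j` on `D(b)`. Equality on
the overlap gives `b ^ j * x = a ^ i * y`, so regularity makes `a ^ i` divide `x`, and the quotient
is the extension. -/
lemma surjective_presheaf_map_of_regular_pair (X : Scheme.{u}) [IsAffine X] [IsIntegral X]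
    {a b : Γ(X, ⊤)} (ha : a ≠ 0) (hb : b ≠ 0) (h : ∀ x, a ∣ b * x → a ∣ x) (U : X.Opens)
    (hU : X.basicOpen a ≤ U) (hU' : X.basicOpen b ≤ U) :
    Function.Surjective (X.presheaf.map (homOfLE (le_top : U ≤ ⊤)).op) := by
  have hne (f : Γ(X, ⊤)) (hf : f ≠ 0) : Nonempty (X.basicOpen f) := by
    rw [← not_isEmpty_iff]
    intro he
    exact hf ((basicOpen_eq_bot_iff f).mp (by
      ext x
      exact ⟨fun hx => (he.false ⟨x, hx⟩).elim, fun hx => hx.elim⟩))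
  have hloc (f : Γ(X, ⊤)) (hf : X.basicOpen f ≤ U) (s : Γ(X, U)) : ∃ (i : ℕ) (x : Γ(X, ⊤)),
      X.presheaf.map (homOfLE hf).op s *
        X.presheaf.map (homOfLE (le_top : X.basicOpen f ≤ ⊤)).op (f ^ i) =
        X.presheaf.map (homOfLE (le_top : X.basicOpen f ≤ ⊤)).op x := by
    have := (isAffineOpen_top X).isLocalization_basicOpen f
    obtain ⟨i, x, hx⟩ := IsLocalization.Away.surj f (X.presheaf.map (homOfLE hf).op s)
    refine ⟨i, x, ?_⟩
    rw [map_pow]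
    exact hx
  intro s
  obtain ⟨i, x, hx⟩ := hloc a hU s
  obtain ⟨j, y, hy⟩ := hloc b hU' s
  have hab : a * b ≠ 0 := mul_ne_zero ha hb
  have hxy : b ^ j * x = a ^ i * y := by
    have hA : X.basicOpen (a * b) ≤ X.basicOpen a := by
      rw [X.basicOpen_mul]; exact inf_le_left
    have hB : X.basicOpen (a * b) ≤ X.basicOpen b := by
      rw [X.basicOpen_mul]; exact inf_le_right
    have := hne _ hab
    -- On an integral scheme restriction to a nonempty open subset is injective, so the identity may
    -- be checked on `D(ab)`, where both fractions represent `s`.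
    apply map_injective_of_isIntegral X (homOfLE (le_top : X.basicOpen (a * b) ≤ ⊤))
    have hx' := congrArg (X.presheaf.map (homOfLE hA).op) hx
    have hy' := congrArg (X.presheaf.map (homOfLE hB).op) hy
    simp only [map_mul, ← CategoryTheory.comp_apply, ← Functor.map_comp, ← op_comp, homOfLE_comp]
      at hx' hy' ⊢
    rw [← hx', ← hy']
    ring
  obtain ⟨r, rfl⟩ := dvd_of_pow_dvd_pow_mul ha h i j x ⟨y, hxy⟩
  refine ⟨r, ?_⟩
  have := hne a ha
  apply map_injective_of_isIntegral X (homOfLE hU)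
  have hu : (X.presheaf.map (homOfLE (le_top : X.basicOpen a ≤ ⊤)).op) (a ^ i) ≠ 0 := by
    intro h0
    exact pow_ne_zero i ha (map_injective_of_isIntegral X
      (homOfLE (le_top : X.basicOpen a ≤ ⊤)) (h0.trans (map_zero _).symm))
  rw [map_mul, mul_comm] at hx
  have := mul_left_cancel₀ hu hx
  rw [this]
  simp only [← CategoryTheory.comp_apply, ← Functor.map_comp, ← op_comp, homOfLE_comp]

variable (k : Type u) [Field k] (R : Type u) [CommRing R] [Algebra k R] [IsLocalRing R]

/-- The punctured spectrum contains `D(f)` for every `f` in the maximal ideal, in particular for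
both members of a regular pair. The rest of the argument translates between sections over the open
subset and global functions on it as a scheme. -/
lemma surjective_functions_map_openInclusion (hR : IsSingularity R) :
    Function.Surjective (Functions.map k (openInclusion (puncturedSpec R))) := by
  have := hR.isDomain
  obtain ⟨a, b, ham, hbm, ha, hb, h⟩ := exists_regular_pair R hR
  let ε := (Scheme.ΓSpecIso (CommRingCat.of R)).commRingCatIsoToRingEquiv
  have hU (f : R) (hf : f ∈ IsLocalRing.maximalIdeal R) :
      (specX R).basicOpen (ε.symm f) ≤ puncturedSpec R := by
    have he : (specX R).basicOpen (ε.symm f) = PrimeSpectrum.basicOpen f := by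
      exact basicOpen_eq_of_affine (R := CommRingCat.of R) f
    rw [he]
    intro x hx hx'
    have hx'' : x = IsLocalRing.closedPoint R := hx'
    subst hx''
    exact hx hf
  have hs := surjective_presheaf_map_of_regular_pair (specX R) (a := ε.symm a) (b := ε.symm b)
    (by simpa using ha) (by simpa using hb) (fun x hx => by
      obtain ⟨y, hy⟩ := hx
      obtain ⟨z, hz⟩ := h (ε x) ⟨ε y, by simpa using congrArg ε hy⟩
      exact ⟨ε.symm z, by simpa using congrArg ε.symm hz⟩) (puncturedSpec R) (hU a ham) (hU b hbm)
  intro s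
  have hι : (openInclusion (puncturedSpec R)).left = (puncturedSpec R).ι :=
    (Category.comp_id _).symm.trans (Over.w (openInclusion (puncturedSpec R)))
  obtain ⟨t, ht⟩ := hs ((puncturedSpec R).topIso.hom s)
  refine ⟨t, ?_⟩
  change (openInclusion (puncturedSpec R)).left.appTop t = s
  have : (puncturedSpec R).ι.appTop ≫ (puncturedSpec R).topIso.hom =
      (specX R).presheaf.map (homOfLE (le_top : puncturedSpec R ≤ ⊤)).op := by
    simp
    rfl
  rw [hι]
  apply (puncturedSpec R).topIso.commRingCatIsoToRingEquiv.injective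
  exact (ConcreteCategory.congr_hom this t).trans ht

end Extension

/-! ### Sections of sheaves and homomorphisms from free sheaves -/

section Sections

lemma isSheaf_sections {C : Type*} [Category.{u} C] {J : GrothendieckTopology C}
    (G : Sheaf J AddCommGrpCat.{u + 1}) :
    Presieve.IsSheaf J (G.obj ⋙ forget _) :=
  (isSheaf_iff_isSheaf_of_type _ _).mp
    ((sheafCompose J (forget AddCommGrpCat.{u + 1})).obj G).property

open Opposite

variable {C : Type*} [Category.{u} C] {J : GrothendieckTopology C}
  [HasSheafify J AddCommGrpCat.{u + 1}]

/-- The section over `T` that corresponds to a homomorphism `ℤ_T → G`. -/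
def homSection {T : C} {G : Sheaf J AddCommGrpCat.{u + 1}} (f : (freeSheaf J).obj T ⟶ G) :
    G.obj.obj (op T) :=
  f.hom.app (op T) (freeSheafSection J T)

/-- The bijection between homomorphisms `ℤ_T → G` and sections of `G` over `T`. -/
def freeSheafHomEquiv (T : C) (G : Sheaf J AddCommGrpCat.{u + 1}) :
    ((freeSheaf J).obj T ⟶ G) ≃ G.obj.obj (op T) :=
  ((sheafificationAdjunction J AddCommGrpCat.{u + 1}).homEquiv _ _).trans
    (((AddCommGrpCat.adj.{u + 1}.whiskerRight Cᵒᵖ).homEquiv _ _).trans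
      uliftYonedaEquiv.{u + 1})

lemma homSection_injective {T : C} {G : Sheaf J AddCommGrpCat.{u + 1}}
    {f f' : (freeSheaf J).obj T ⟶ G} (h : homSection f = homSection f') : f = f' :=
  (freeSheafHomEquiv T G).injective h

@[simp]
lemma homSection_freeSheafDesc {T : C} {G : Sheaf J AddCommGrpCat.{u + 1}}
    (s : G.obj.obj (op T)) : homSection (freeSheafDesc s) = s :=
  (freeSheafHomEquiv T G).apply_symm_apply s

lemma homSection_comp {T : C} {G G' : Sheaf J AddCommGrpCat.{u + 1}}
    (f : (freeSheaf J).obj T ⟶ G) (φ : G ⟶ G') :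
    homSection (f ≫ φ) = φ.hom.app (op T) (homSection f) := rfl

/-- Both sides are the image under sheafification of the free generator `j`. -/
lemma freeSheaf_map_section {T T' : C} (j : T ⟶ T') :
    ((freeSheaf J).map j).hom.app (op T) (freeSheafSection J T) =
      ((freeSheaf J).obj T').obj.map j.op (freeSheafSection J T') := by
  let P : C ⥤ Cᵒᵖ ⥤ AddCommGrpCat.{u + 1} :=
    uliftYoneda.{u + 1} ⋙ (Functor.whiskeringRight _ _ _).obj AddCommGrpCat.free.{u + 1}
  have h1 := toSheafify_naturality J (P.map j)
  let x (T : C) : (P.obj T).obj (op T) :=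
    (FreeAbelianGroup.of (ULift.up.{u + 1} (𝟙 T)) : FreeAbelianGroup (ULift.{u + 1} (T ⟶ T)))
  have h2 := ConcreteCategory.congr_hom (congr_app h1 (op T)) (x T)
  have h3 := ConcreteCategory.congr_hom ((toSheafify J (P.obj T')).naturality j.op) (x T')
  refine Eq.trans h2.symm (Eq.trans ?_ h3)
  refine congrArg ((toSheafify J (P.obj T')).app (op T)) ?_
  change FreeAbelianGroup.map _ (FreeAbelianGroup.of _) =
    FreeAbelianGroup.map _ (FreeAbelianGroup.of _)
  rw [FreeAbelianGroup.map_of_apply, FreeAbelianGroup.map_of_apply]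
  refine congrArg FreeAbelianGroup.of (ULift.ext _ _ ?_)
  change 𝟙 T ≫ j = j ≫ 𝟙 T'
  simp

lemma homSection_map_comp {T T' : C} (j : T ⟶ T') {G : Sheaf J AddCommGrpCat.{u + 1}}
    (f : (freeSheaf J).obj T' ⟶ G) :
    homSection ((freeSheaf J).map j ≫ f) = G.obj.map j.op (homSection f) := by
  change f.hom.app (op T) (((freeSheaf J).map j).hom.app (op T) (freeSheafSection J T)) = _
  rw [freeSheaf_map_section]
  exact ConcreteCategory.congr_hom (f.hom.naturality j.op) (freeSheafSection J T')

/-- Sections over `T` are homomorphisms from `ℤ_T`, so taking sections is left exact. -/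
lemma exists_section_of_shortExact {S : ShortComplex (Sheaf J AddCommGrpCat.{u + 1})}
    (hS : S.ShortExact) {T : C} (s : S.X₂.obj.obj (op T)) (hs : S.g.hom.app (op T) s = 0) :
    ∃ t : S.X₁.obj.obj (op T), S.f.hom.app (op T) t = s := by
  have := hS.mono_f
  have h0 : freeSheafDesc s ≫ S.g = 0 := by
    apply homSection_injective
    rw [homSection_comp, homSection_freeSheafDesc, hs]
    rfl
  refine ⟨homSection (hS.exact.lift _ h0), ?_⟩
  rw [← homSection_comp, hS.exact.lift_f, homSection_freeSheafDesc]

lemma section_injective_of_mono {G G' : Sheaf J AddCommGrpCat.{u + 1}} (φ : G ⟶ G') [Mono φ]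
    (T : C) : Function.Injective (φ.hom.app (op T)) := by
  intro s t h
  have : freeSheafDesc s ≫ φ = freeSheafDesc t ≫ φ := by
    apply homSection_injective
    rw [homSection_comp, homSection_comp, homSection_freeSheafDesc, homSection_freeSheafDesc, h]
  rw [← homSection_freeSheafDesc s, (cancel_mono φ).mp this, homSection_freeSheafDesc]

/-- This turns surjectivity on sections into a lifting property of `ℤ_T`, the form needed for
computations with `Ext`. -/
lemma exists_homSection_lift {G G' : Sheaf J AddCommGrpCat.{u + 1}} (φ : G ⟶ G') (T : C)
    (h : Function.Surjective (φ.hom.app (op T))) (f : (freeSheaf J).obj T ⟶ G') :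
    ∃ f', f' ≫ φ = f := by
  obtain ⟨s, hs⟩ := h (homSection f)
  exact ⟨freeSheafDesc s, homSection_injective (by
    rw [homSection_comp, homSection_freeSheafDesc, hs])⟩

end Sections

/-! ### Coverings of affine schemes in the fppf topology -/

section Coverings

open Opposite

variable {X : Scheme.{u}}

/-- A scheme over `T`, as a scheme over `X`. -/
abbrev overComp (T : Over X) {Y : Scheme.{u}} (f : Y ⟶ T.left) : Over X := Over.mk (f ≫ T.hom)

/-- The structure morphism of a scheme over `T`, as a morphism of schemes over `X`. -/
abbrev overCompHom (T : Over X) {Y : Scheme.{u}} (f : Y ⟶ T.left) : overComp T f ⟶ T :=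
  Over.homMk f

lemma generate_ofArrows_mem_flTop (T : Over X) {ι : Type*} {Y : ι → Scheme.{u}}
    (f : ∀ i, Y i ⟶ T.left) (h : Presieve.ofArrows Y f ∈ Scheme.fppfPrecoverage T.left) :
    Sieve.generate (Presieve.ofArrows (fun i => overComp T (f i)) fun i => overCompHom T (f i)) ∈
      flTop X T := by
  rw [GrothendieckTopology.mem_over_iff]
  refine GrothendieckTopology.superset_covering _ ?_ (Precoverage.generate_mem_toGrothendieck h)
  refine (Sieve.generate_le_iff _ _).mpr ?_
  rintro _ _ ⟨i⟩
  refine (Sieve.overEquiv_iff (Y := T) _ _).mpr ?_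
  exact ⟨_, 𝟙 _, overCompHom T (f i), ⟨i⟩, Category.id_comp _⟩

lemma ext_of_cover (F : Sheaf (flTop X) AddCommGrpCat.{u + 1}) (T : Over X) {ι : Type*}
    {Y : ι → Scheme.{u}} (f : ∀ i, Y i ⟶ T.left)
    (h : Presieve.ofArrows Y f ∈ Scheme.fppfPrecoverage T.left) (s t : F.obj.obj (op T))
    (hst : ∀ i, F.obj.map (overCompHom T (f i)).op s = F.obj.map (overCompHom T (f i)).op t) :
    s = t := by
  have hF := isSheaf_sections F
  refine ((Presieve.isSeparatedFor_iff_generate (P := F.obj ⋙ forget _)).mpr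
    (hF.isSeparated _ (generate_ofArrows_mem_flTop T f h))).ext ?_
  rintro _ _ ⟨i⟩
  exact hst i

lemma glue_of_cover (F : Sheaf (flTop X) AddCommGrpCat.{u + 1}) (T : Over X) {ι : Type*}
    {Y : ι → Scheme.{u}} (f : ∀ i, Y i ⟶ T.left)
    (h : Presieve.ofArrows Y f ∈ Scheme.fppfPrecoverage T.left)
    (s : ∀ i, F.obj.obj (op (overComp T (f i))))
    (hs : ∀ (i j : ι) (Z : Over X) (a : Z ⟶ overComp T (f i)) (b : Z ⟶ overComp T (f j)),
      a ≫ overCompHom T (f i) = b ≫ overCompHom T (f j) →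
        F.obj.map a.op (s i) = F.obj.map b.op (s j)) :
    ∃ t : F.obj.obj (op T), ∀ i, F.obj.map (overCompHom T (f i)).op t = s i := by
  have hF := isSheaf_sections F
  have h1 := (Presieve.isSheafFor_iff_generate (P := F.obj ⋙ forget _) _).mpr
    (hF _ (generate_ofArrows_mem_flTop T f h))
  obtain ⟨t, ht, -⟩ := (Presieve.isSheafFor_arrows_iff _ _).mp h1 s
    (fun i j Z a b hab => hs i j Z a b hab)
  exact ⟨t, ht⟩

/-- The empty family covers the empty scheme. -/
lemma sections_eq_of_isEmpty (F : Sheaf (flTop X) AddCommGrpCat.{u + 1}) (T : Over X)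
    [IsEmpty T.left] (s t : F.obj.obj (op T)) : s = t := by
  refine ext_of_cover F T (ι := PEmpty.{1}) (Y := fun i => i.elim) (fun i => i.elim) ?_ s t
    (fun i => i.elim)
  refine (Scheme.ofArrows_mem_precoverage_iff _).mpr ⟨fun x => isEmptyElim x, fun i => i.elim⟩

/-- A section that lifts along `φ` over the members of a finite family lifts over their disjoint
union. -/
lemma imageSieve_sigmaDesc {F G : Sheaf (flTop X) AddCommGrpCat.{u + 1}} (φ : F ⟶ G) (T : Over X)
    (q : G.obj.obj (op T)) {ι : Type*} [Small.{u} ι] (Y : ι → Scheme.{u})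
    (f : ∀ i, Y i ⟶ T.left)
    (h : ∀ i, ∃ s : F.obj.obj (op (overComp T (f i))),
      φ.hom.app _ s = G.obj.map (overCompHom T (f i)).op q) :
    ∃ s : F.obj.obj (op (overComp T (Sigma.desc f))),
      φ.hom.app _ s = G.obj.map (overCompHom T (Sigma.desc f)).op q := by
  choose s hs using h
  let D := overComp T (Sigma.desc f)
  have hcov : Presieve.ofArrows Y (fun i => (Sigma.ι Y i : Y i ⟶ D.left)) ∈
      Scheme.fppfPrecoverage D.left := by
    apply Scheme.zariskiPrecoverage_le_fppfPrecoverage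
    exact (sigmaOpenCover Y).mem₀
  let α (i : ι) : overComp D (Sigma.ι Y i) ⟶ overComp T (f i) := Over.homMk (𝟙 _) (by simp [D])
  have hα (i : ι) : α i ≫ overCompHom T (f i) =
      overCompHom D (Sigma.ι Y i) ≫ overCompHom T (Sigma.desc f) := by
    ext1
    simp [α]
  obtain ⟨t, ht⟩ := glue_of_cover F D (fun i => Sigma.ι Y i) hcov
    (fun i => F.obj.map (α i).op (s i)) (by
      intro i j Z a b hab
      -- For equal indices the two morphisms agree because coproduct inclusions are monomorphisms;
      -- for different indices the summands are disjoint, so `Z` is empty and there is nothing to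
      -- compare.
      by_cases hij : i = j
      · subst hij
        have : a = b := by
          ext1
          have := congrArg Over.Hom.left hab
          simp only [Over.comp_left, Over.homMk_left] at this
          exact (cancel_mono (Sigma.ι Y i)).mp this
        rw [this]
      · have : IsEmpty Z.left := ⟨fun z => by
          have h1 := congrArg (fun g => g.left z) hab
          simp only [Over.comp_left, Over.homMk_left, Scheme.Hom.comp_apply] at h1
          have := disjoint_opensRange_sigmaι Y i j hij
          rw [disjoint_iff] at this
          have hmem : (Sigma.ι Y i) (a.left z) ∈
              (Sigma.ι Y i).opensRange ⊓ (Sigma.ι Y j).opensRange :=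
            ⟨⟨_, rfl⟩, ⟨_, h1.symm⟩⟩
          rw [this] at hmem
          exact hmem⟩
        exact sections_eq_of_isEmpty F Z _ _)
  refine ⟨t, ext_of_cover G D (fun i => Sigma.ι Y i) hcov _ _ fun i => ?_⟩
  have h1 := ConcreteCategory.congr_hom (φ.hom.naturality (overCompHom D (Sigma.ι Y i)).op) t
  have h2 := ConcreteCategory.congr_hom (φ.hom.naturality (α i).op) (s i)
  refine h1.symm.trans ?_
  refine (congrArg (φ.hom.app _) (ht i)).trans (h2.trans ?_)
  refine (congrArg (G.obj.map (α i).op) (hs i)).trans ?_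
  simp only [← CategoryTheory.comp_apply, ← Functor.map_comp, ← op_comp]
  rw [hα]

/-- Flat morphisms locally of finite presentation. -/
def flatLfp : MorphismProperty Scheme.{u} := fun _ _ f => Flat f ∧ LocallyOfFinitePresentation f

instance : flatLfp.{u}.ContainsIdentities := ⟨fun _ => ⟨inferInstance, inferInstance⟩⟩

instance : flatLfp.{u}.RespectsLeft @IsOpenImmersion where
  precomp _ (_ : IsOpenImmersion _) _ h := by
    obtain ⟨_, _⟩ := h
    exact ⟨inferInstance, inferInstance⟩

instance : flatLfp.{u}.RespectsIso := .mk _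
  (fun _ _ h => by obtain ⟨_, _⟩ := h; exact ⟨inferInstance, inferInstance⟩)
  (fun _ _ h => by obtain ⟨_, _⟩ := h; exact ⟨inferInstance, inferInstance⟩)

/-- Every covering of an affine scheme in the fppf topology is refined by a finite family of
affine schemes. -/
lemma exists_affine_refinement (A : CommRingCat.{u}) (S : Sieve (Spec A))
    (hS : S ∈ Scheme.fppfTopology (Spec A)) :
    ∃ (ι : Type (u + 1)) (_ : Finite ι) (B : ι → CommRingCat.{u}) (f : ∀ i, Spec (B i) ⟶ Spec A),
      (∀ i, S (f i)) ∧ (∀ i, flatLfp (f i)) ∧ ∀ x : Spec A, ∃ i y, f i y = x := by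
  have : Scheme.fppfPrecoverage.{u}.HasIsos :=
    inferInstanceAs (Scheme.precoverage flatLfp).HasIsos
  obtain ⟨R, hR, hRS⟩ :=
    (Precoverage.mem_toGrothendieck_iff_of_isStableUnderComposition).mp hS
  obtain ⟨𝒰, rfl⟩ := Precoverage.mem_iff_exists_zeroHypercover.mp hR
  let 𝒰' : (Spec A).Cover (Scheme.precoverage flatLfp) := 𝒰
  -- Flat morphisms locally of finite presentation are open, so quasi-compactness of the affine base
  -- allows a refinement by finitely many affine schemes.
  have : QuasiCompactCover 𝒰'.toPreZeroHypercover := .of_isOpenMap fun i => by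
    obtain ⟨h1, h2⟩ := Scheme.Cover.map_prop 𝒰' i
    have : Flat (𝒰'.f i) := h1
    have : LocallyOfFinitePresentation (𝒰'.f i) := h2
    exact (𝒰'.f i).isOpenMap
  obtain ⟨𝒱, f, hfin, ho⟩ := QuasiCompactCover.exists_hom 𝒰'
  refine ⟨𝒱.I₀, hfin, 𝒱.X, 𝒱.f, fun i => ?_, fun i => 𝒱.map_prop i, fun x => ?_⟩
  · have h := f.w₀ i
    have h' : f.h₀ i ≫ 𝒰'.f (f.s₀ i) = 𝒱.f i := h
    rw [← h']
    exact S.downward_closed (hRS _ _ (Presieve.ofArrows.mk (f.s₀ i))) _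
  · obtain ⟨y, hy⟩ := 𝒱.covers x
    exact ⟨_, y, hy⟩

end Coverings

/-! ### Vanishing of the first flat cohomology over affine schemes -/

section Descent

open Opposite
open scoped TensorProduct
open Algebra.TensorProduct (includeLeft includeRight)

variable {X : Scheme.{u}}

/-- The spectrum of an `A`-algebra, as a scheme over `X`, for a morphism `Spec A → X`. -/
abbrev specOver {A : Type u} [CommRing A] (g : Spec (CommRingCat.of A) ⟶ X) (B : Type u)
    [CommRing B] [Algebra A B] : Over X :=
  Over.mk (Spec.map (CommRingCat.ofHom (algebraMap A B)) ≫ g)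

/-- The morphism of spectra induced by a homomorphism of `A`-algebras. -/
abbrev specOverMap {A : Type u} [CommRing A] (g : Spec (CommRingCat.of A) ⟶ X) {B C : Type u}
    [CommRing B] [Algebra A B] [CommRing C] [Algebra A C] (φ : B →ₐ[A] C) :
    specOver g C ⟶ specOver g B :=
  Over.homMk (Spec.map (CommRingCat.ofHom φ.toRingHom)) (by
    simp only [Over.mk_left, Over.mk_hom, ← Category.assoc, ← Spec.map_comp,
      ← CommRingCat.ofHom_comp]
    rw [AlgHom.toRingHom_eq_coe, AlgHom.comp_algebraMap])

lemma specOverMap_comp {A : Type u} [CommRing A] (g : Spec (CommRingCat.of A) ⟶ X)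
    {B C D : Type u} [CommRing B] [Algebra A B] [CommRing C] [Algebra A C] [CommRing D]
    [Algebra A D] (φ : B →ₐ[A] C) (ψ : C →ₐ[A] D) :
    specOverMap g ψ ≫ specOverMap g φ = specOverMap g (ψ.comp φ) := by
  ext1
  simp only [Over.comp_left, Over.homMk_left, ← Spec.map_comp]
  rfl

/-- The condition that the first Čech cohomology of a sheaf vanishes for every faithfully flat
covering of an affine scheme by an affine scheme. -/
def CechAcyclic (G : Sheaf (flTop X) AddCommGrpCat.{u + 1}) : Prop :=
  ∀ (A B : Type u) [CommRing A] [CommRing B] [Algebra A B] [Module.FaithfullyFlat A B]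
    (g : Spec (CommRingCat.of A) ⟶ X) (c : G.obj.obj (op (specOver g (B ⊗[A] B)))),
    G.obj.map (specOverMap g (coface₀ A B)).op c - G.obj.map (specOverMap g (coface₁ A B)).op c +
      G.obj.map (specOverMap g (coface₂ A B)).op c = 0 →
    ∃ b : G.obj.obj (op (specOver g B)),
      c = G.obj.map (specOverMap g (includeRight : B →ₐ[A] B ⊗[A] B)).op b -
        G.obj.map (specOverMap g (includeLeft : B →ₐ[A] B ⊗[A] B)).op b

/-- The fibre product of `Spec B` with itself over `Spec A` is `Spec (B ⊗[A] B)`, so compatibility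
on all test objects follows from compatibility on this universal one. -/
lemma glue_of_faithfullyFlat (F : Sheaf (flTop X) AddCommGrpCat.{u + 1}) {A B : Type u}
    [CommRing A] [CommRing B] [Algebra A B]
    (hB : Presieve.singleton (Spec.map (CommRingCat.ofHom (algebraMap A B))) ∈
      Scheme.fppfPrecoverage (Spec (CommRingCat.of A)))
    (g : Spec (CommRingCat.of A) ⟶ X) (s : F.obj.obj (op (specOver g B)))
    (hs : F.obj.map (specOverMap g (includeRight : B →ₐ[A] B ⊗[A] B)).op s =
      F.obj.map (specOverMap g (includeLeft : B →ₐ[A] B ⊗[A] B)).op s) :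
    ∃ t : F.obj.obj (op (Over.mk g)),
      F.obj.map (overCompHom (Over.mk g) (Spec.map (CommRingCat.ofHom (algebraMap A B)))).op t =
        s := by
  rw [← Presieve.ofArrows_pUnit.{0}] at hB
  obtain ⟨t, ht⟩ := glue_of_cover F (Over.mk g) _ hB (fun _ => s) (by
    rintro ⟨⟩ ⟨⟩ Z a b hab
    have hp := isPullback_SpecMap_of_isPushout _ _ _ _ (CommRingCat.isPushout_tensorProduct A B B)
    have hab' := congrArg Over.Hom.left hab
    simp only [Over.comp_left, Over.homMk_left] at hab'
    let l : Z.left ⟶ Spec (CommRingCat.of (B ⊗[A] B)) := hp.lift a.left b.left hab'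
    have hl1 : l ≫ Spec.map (CommRingCat.ofHom (includeLeft : B →ₐ[A] B ⊗[A] B).toRingHom) =
      a.left := hp.lift_fst _ _ _
    have hl2 : l ≫ Spec.map (CommRingCat.ofHom (includeRight : B →ₐ[A] B ⊗[A] B).toRingHom) =
      b.left := hp.lift_snd _ _ _
    let l' : Z ⟶ specOver g (B ⊗[A] B) := Over.homMk l (by
      have h1 := Over.w (specOverMap g (includeLeft : B →ₐ[A] B ⊗[A] B))
      simp only [Over.homMk_left] at h1
      rw [← h1, ← Category.assoc]
      exact (congrArg (· ≫ _) hl1).trans (Over.w a))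
    have h1 : l' ≫ specOverMap g (includeLeft : B →ₐ[A] B ⊗[A] B) = a := by
      ext1; exact hl1
    have h2 : l' ≫ specOverMap g (includeRight : B →ₐ[A] B ⊗[A] B) = b := by
      ext1; exact hl2
    rw [← h1, ← h2, op_comp, op_comp, F.obj.map_comp, F.obj.map_comp]
    exact congrArg (F.obj.map l'.op) hs.symm)
  exact ⟨t, ht ⟨⟩⟩

/-- The obstruction to descending the local lift `s` is the difference of its two pullbacks, a Čech
cocycle with values in the kernel. Acyclicity writes it as the coboundary of some `b`, and `s` minus
the image of `b` descends to a lift of `q`. -/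
lemma exists_lift_of_faithfullyFlat {S : ShortComplex (Sheaf (flTop X) AddCommGrpCat.{u + 1})}
    (hS : S.ShortExact) (hG : CechAcyclic S.X₁) {A B : Type u}
    [CommRing A] [CommRing B] [Algebra A B] [Module.FaithfullyFlat A B]
    (hB : Presieve.singleton (Spec.map (CommRingCat.ofHom (algebraMap A B))) ∈
      Scheme.fppfPrecoverage (Spec (CommRingCat.of A)))
    (g : Spec (CommRingCat.of A) ⟶ X) (q : S.X₃.obj.obj (op (Over.mk g)))
    (s : S.X₂.obj.obj (op (specOver g B)))
    (hs : S.g.hom.app _ s = S.X₃.obj.map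
      (overCompHom (Over.mk g) (Spec.map (CommRingCat.ofHom (algebraMap A B)))).op q) :
    ∃ t, S.g.hom.app (op (Over.mk g)) t = q := by
  have := hS.mono_f
  let π := overCompHom (Over.mk g) (Spec.map (CommRingCat.ofHom (algebraMap A B)))
  let p₁ := specOverMap g (includeLeft : B →ₐ[A] B ⊗[A] B)
  let p₂ := specOverMap g (includeRight : B →ₐ[A] B ⊗[A] B)
  have hπ : p₁ ≫ π = p₂ ≫ π := by
    ext1
    simp only [π, p₁, p₂, Over.comp_left, Over.homMk_left, ← Spec.map_comp,
      ← CommRingCat.ofHom_comp]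
    rw [AlgHom.toRingHom_eq_coe, AlgHom.comp_algebraMap, AlgHom.toRingHom_eq_coe,
      AlgHom.comp_algebraMap]
  have hg {T T' : Over X} (f : T ⟶ T') (x : S.X₂.obj.obj (op T')) :
      S.g.hom.app (op T) (S.X₂.obj.map f.op x) = S.X₃.obj.map f.op (S.g.hom.app (op T') x) :=
    ConcreteCategory.congr_hom (S.g.hom.naturality f.op) x
  have hf {T T' : Over X} (f : T ⟶ T') (x : S.X₁.obj.obj (op T')) :
      S.f.hom.app (op T) (S.X₁.obj.map f.op x) = S.X₂.obj.map f.op (S.f.hom.app (op T') x) :=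
    ConcreteCategory.congr_hom (S.f.hom.naturality f.op) x
  have hcomp (F : Sheaf (flTop X) AddCommGrpCat.{u + 1}) {T T' T'' : Over X} (f : T ⟶ T')
      (f' : T' ⟶ T'') (x : F.obj.obj (op T'')) :
      F.obj.map f.op (F.obj.map f'.op x) = F.obj.map (f ≫ f').op x := by
    rw [op_comp, F.obj.map_comp]; rfl
  have hzero {T : Over X} (x : S.X₁.obj.obj (op T)) :
      S.g.hom.app (op T) (S.f.hom.app (op T) x) = 0 :=
    ConcreteCategory.congr_hom (congr_app (congrArg (fun f => f.hom) S.zero) (op T)) x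
  obtain ⟨c, hc⟩ := exists_section_of_shortExact hS (T := specOver g (B ⊗[A] B))
    (S.X₂.obj.map p₂.op s - S.X₂.obj.map p₁.op s) (by
      rw [map_sub, hg, hg, hs, hcomp, hcomp, hπ, sub_self])
  -- The cocycle condition is checked after the injection into the middle sheaf, where `c` becomes a
  -- difference of pullbacks and the cosimplicial identities apply.
  obtain ⟨b, hb⟩ := hG A B g c (by
    apply section_injective_of_mono S.f
    rw [map_add, map_sub, map_zero, hf, hf, hf, hc]
    simp only [map_sub, hcomp, p₁, p₂, specOverMap_comp]
    have e1 : (coface₀ A B).comp includeRight = (coface₁ A B).comp includeRight := by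
      ext; simp
    have e2 : (coface₀ A B).comp includeLeft = (coface₂ A B).comp includeRight := by
      ext; simp
    have e3 : (coface₁ A B).comp includeLeft = (coface₂ A B).comp includeLeft := by
      ext; simp
    rw [e1, e2, e3]
    abel)
  obtain ⟨t, ht⟩ := glue_of_faithfullyFlat S.X₂ hB g (s - S.f.hom.app _ b) (by
    rw [map_sub, map_sub, ← hf, ← hf, sub_eq_sub_iff_sub_eq_sub]
    have := congrArg (S.f.hom.app _) hb
    rw [hc, map_sub] at this
    exact this)
  rw [← Presieve.ofArrows_pUnit.{0}] at hB
  refine ⟨t, ext_of_cover S.X₃ (Over.mk g) _ hB _ _ fun _ => ?_⟩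
  rw [← hg]
  refine (congrArg (S.g.hom.app _) ht).trans ?_
  rw [map_sub]
  exact (congrArg₂ (· - ·) hs (hzero b)).trans (sub_zero _)

/-- An epimorphism of sheaves lifts `q` over some fppf covering. The covering can be refined by a
finite affine family, and then replaced by the disjoint union of its members, which is the spectrum
of one faithfully flat `A`-algebra; `exists_lift_of_faithfullyFlat` removes this last covering. -/
lemma surjective_sections_spec {S : ShortComplex (Sheaf (flTop X) AddCommGrpCat.{u + 1})}
    (hS : S.ShortExact) (hG : CechAcyclic S.X₁) (A : Type u) [CommRing A]
    (g : Spec (CommRingCat.of A) ⟶ X) :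
    Function.Surjective (S.g.hom.app (op (Over.mk g))) := by
  intro q
  have := hS.epi_g
  have hloc : Sheaf.IsLocallySurjective S.g := (Sheaf.isLocallySurjective_iff_epi' _ S.g).mpr this
  have hcov := Presheaf.imageSieve_mem (flTop X) S.g.hom q
  rw [GrothendieckTopology.mem_over_iff] at hcov
  obtain ⟨ι, hι, B, f, hf, hfp, hx⟩ := exists_affine_refinement _ _ hcov
  have hlift := imageSieve_sigmaDesc S.g (Over.mk g) q (fun i => Spec (B i)) f fun i => by
    have := (Sieve.overEquiv_iff (Y := Over.mk g) _ _).mp (hf i)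
    exact this
  let Y : Scheme.{u} := ∐ fun i => Spec (B i)
  -- Finiteness of the family is essential here.
  have hY : IsAffine Y := by dsimp only [Y]; infer_instance
  let d : Y ⟶ Spec (CommRingCat.of A) := Sigma.desc f
  have (i : ι) : Flat (f i) := (hfp i).1
  have : Flat d := by dsimp only [d]; infer_instance
  have : IsZariskiLocalAtSource @LocallyOfFinitePresentation.{u} :=
    HasRingHomProperty.instIsZariskiLocalAtSource (Q := RingHom.FinitePresentation)
  have : LocallyOfFinitePresentation d :=
    IsZariskiLocalAtSource.sigmaDesc (P := @LocallyOfFinitePresentation) fun i => (hfp i).2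
  have : Surjective d := ⟨fun x => by
    obtain ⟨i, y, hy⟩ := hx x
    refine ⟨(Sigma.ι (fun i => Spec (B i)) i) y, ?_⟩
    rw [← Scheme.Hom.comp_apply]
    simpa [d] using hy⟩
  obtain ⟨φ, hφ⟩ := Spec.map_surjective (Y.isoSpec.inv ≫ d)
  algebraize [φ.hom]
  have hφ' : Spec.map (CommRingCat.ofHom (algebraMap A Γ(Y, ⊤))) = Y.isoSpec.inv ≫ d := hφ
  have hflat : Flat (Spec.map φ) := by rw [hφ]; infer_instance
  have hsurj : Surjective (Spec.map φ) := by rw [hφ]; infer_instance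
  have hff : Module.FaithfullyFlat A Γ(Y, ⊤) := (flat_and_surjective_SpecMap_iff φ).mp ⟨hflat, hsurj⟩
  obtain ⟨s, hs⟩ := hlift
  let e : specOver g Γ(Y, ⊤) ⟶ overComp (Over.mk g) d := Over.homMk Y.isoSpec.inv (by
    simp [hφ'])
  refine exists_lift_of_faithfullyFlat hS hG (B := Γ(Y, ⊤)) ?_ g q (S.X₂.obj.map e.op s) ?_
  · rw [hφ']
    exact Scheme.Hom.singleton_mem_fppfPrecoverage _
  · refine (ConcreteCategory.congr_hom (S.g.hom.naturality e.op) s).trans ?_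
    refine (congrArg (S.X₃.obj.map e.op) hs).trans ?_
    simp only [← CategoryTheory.comp_apply, ← Functor.map_comp, ← op_comp]
    congr 4
    ext1
    exact hφ'.symm

lemma surjective_sections_of_isAffine {S : ShortComplex (Sheaf (flTop X) AddCommGrpCat.{u + 1})}
    (hS : S.ShortExact) (hG : CechAcyclic S.X₁) (T : Over X) [IsAffine T.left] :
    Function.Surjective (S.g.hom.app (op T)) := by
  intro q
  let T' : Over X := Over.mk (T.left.isoSpec.inv ≫ T.hom)
  let e : T' ≅ T := Over.isoMk T.left.isoSpec.symm
  obtain ⟨s, hs⟩ := surjective_sections_spec hS hG Γ(T.left, ⊤) (T.left.isoSpec.inv ≫ T.hom)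
    (S.X₃.obj.map e.hom.op q)
  refine ⟨S.X₂.obj.map e.inv.op s, ?_⟩
  refine (ConcreteCategory.congr_hom (S.g.hom.naturality e.inv.op) s).trans ?_
  refine (congrArg (S.X₃.obj.map e.inv.op) hs).trans ?_
  simp only [← CategoryTheory.comp_apply, ← Functor.map_comp, ← op_comp]
  simp

end Descent

/-! ### The sheaf of Witt vectors on the fppf site -/

section WittCech

open Opposite
open scoped TensorProduct
open Algebra.TensorProduct (includeLeft includeRight)

variable (p : ℕ) [Fact p.Prime] (k : Type u) [Field k] [CharP k p] [PerfectRing k p]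
variable (R : Type u) [CommRing R] [Algebra k R]

/-- The Witt vectors over `C` that correspond to a section of `𝐖_n` over `Spec C`. -/
def specWitt {A : Type u} [CommRing A] (n : ℕ) (g : Spec (CommRingCat.of A) ⟶ specX R)
    (C : Type u) [CommRing C] [Algebra A C] :
    (wittSheaf p k R n).sheaf.obj.obj (op (specOver g C)) →+ TruncatedWittVector p n C where
  toFun x := wittMap (p := p) (A := Γ(Spec (CommRingCat.of C), ⊤)) n
    (Scheme.ΓSpecIso (CommRingCat.of C)).hom.hom x.down
  map_zero' := map_zero _
  map_add' _ _ := map_add (wittMap (p := p) (A := Γ(Spec (CommRingCat.of C), ⊤)) n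
    (Scheme.ΓSpecIso (CommRingCat.of C)).hom.hom) _ _

lemma specWitt_bijective {A : Type u} [CommRing A] (n : ℕ)
    (g : Spec (CommRingCat.of A) ⟶ specX R) (C : Type u) [CommRing C] [Algebra A C] :
    Function.Bijective (specWitt p k R n g C) := by
  let ε := (Scheme.ΓSpecIso (CommRingCat.of C)).commRingCatIsoToRingEquiv
  constructor
  · intro x y h
    refine ULift.ext _ _ (TruncatedWittVector.ext (p := p) fun i => ε.injective ?_)
    have := congrArg (TruncatedWittVector.coeff i) h
    exact (coeff_wittMap _ _ _).symm.trans (this.trans (coeff_wittMap _ _ _))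
  · intro y
    refine ⟨ULift.up (wittMap (p := p) n (ε.symm : C →+* Γ(Spec (CommRingCat.of C), ⊤)) y),
      TruncatedWittVector.ext fun i => ?_⟩
    refine (coeff_wittMap _ _ _).trans ?_
    refine (congrArg ε (coeff_wittMap _ _ _)).trans ?_
    exact ε.apply_symm_apply _

lemma specWitt_map {A : Type u} [CommRing A] (n : ℕ) (g : Spec (CommRingCat.of A) ⟶ specX R)
    {B C : Type u} [CommRing B] [Algebra A B] [CommRing C] [Algebra A C] (φ : B →ₐ[A] C)
    (x : (wittSheaf p k R n).sheaf.obj.obj (op (specOver g B))) :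
    specWitt p k R n g C ((wittSheaf p k R n).sheaf.obj.map (specOverMap g φ).op x) =
      wittMap n φ.toRingHom (specWitt p k R n g B x) := by
  ext i
  refine (coeff_wittMap _ _ _).trans ?_
  refine Eq.trans ?_ (coeff_wittMap _ _ _).symm
  refine Eq.trans ?_ (congrArg φ (coeff_wittMap _ _ _).symm)
  refine (congrArg _ (coeff_map_functions p k (specOverMap g φ) x.down i)).trans ?_
  exact ConcreteCategory.congr_hom
    (Scheme.ΓSpecIso_naturality (CommRingCat.ofHom φ.toRingHom)) _

/-- Through `specWitt` the Čech complex of `𝐖_n` becomes the Amitsur complex with values in Witt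
vectors. -/
lemma cechAcyclic_wittSheaf (n : ℕ) : CechAcyclic (wittSheaf p k R n).sheaf := by
  intro A B _ _ _ _ g c hc
  obtain ⟨b, hb⟩ := exists_of_witt_cocycle (p := p) A B n (specWitt p k R n g _ c) (by
    rw [← specWitt_map, ← specWitt_map, ← specWitt_map, ← map_sub, ← map_add, hc, map_zero])
  obtain ⟨b, rfl⟩ := (specWitt_bijective p k R n g B).2 b
  refine ⟨b, (specWitt_bijective p k R n g _).1 ?_⟩
  rw [hb, map_sub, specWitt_map, specWitt_map]

end WittCech

/-! ### The exact sequence of the Frobenius -/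

section Frobenius

open Opposite

variable (p : ℕ) [Fact p.Prime] (k : Type u) [Field k] [CharP k p] [PerfectRing k p]
variable (R : Type u) [CommRing R] [Algebra k R]

lemma wittAction_frob_pow {n : ℕ} {A : Type u} [CommRing A] [Algebra k A] (m : ℕ)
    (x : TruncatedWittVector p n A) (i : Fin n) :
    (wittAction p k n A (DieudonneRing.F p k ^ m) x).coeff i = x.coeff i ^ p ^ m := by
  induction m generalizing x with
  | zero => simp
  | succ m ih =>
    rw [pow_succ, map_mul]
    change (wittAction p k n A (DieudonneRing.F p k ^ m)
      (wittAction p k n A (DieudonneRing.gen p k .frob) x)).coeff i = _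
    rw [ih, wittAction_frob, wittF, coeff_wittMap]
    change (x.coeff i ^ p) ^ p ^ m = x.coeff i ^ p ^ (m + 1)
    rw [← pow_mul, pow_succ']

/-- The `m`-th power of the Frobenius on `𝐖_n`. -/
abbrev frobPow (n m : ℕ) : (wittSheaf p k R n).sheaf ⟶ (wittSheaf p k R n).sheaf :=
  (wittSheaf p k R n).action (DieudonneRing.F p k ^ m)

/-- The sequence `0 → 𝐋_{n,m} → 𝐖_n → 𝐖_n → 0`. -/
def frobSequence (n m : ℕ) : ShortComplex (Sheaf (flTop (specX R)) AddCommGrpCat.{u + 1}) :=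
  ShortComplex.mk (lInclusion p k R n m) (frobPow p k R n m) (by
    apply Sheaf.hom_ext
    ext T x
    exact congrArg ULift.up x.down.2)

instance mono_lInclusion (n m : ℕ) : Mono (lInclusion p k R n m) := by
  have (T : (Over (specX R))ᵒᵖ) : Mono ((lInclusion p k R n m).hom.app T) := by
    rw [AddCommGrpCat.mono_iff_injective]
    intro x y h
    exact ULift.ext _ _ (Subtype.ext (congrArg ULift.down h))
  have : Mono (lInclusion p k R n m).hom := NatTrans.mono_of_mono_app _
  exact (sheafToPresheaf _ _).mono_of_mono_map this

/-- The covering of `Spec A` that extracts a `q`-th root of an element of `A`. -/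
def rootCover {A : Type u} [CommRing A] (a : A) (q : ℕ) :
    Spec (CommRingCat.of (AdjoinRoot (Polynomial.X ^ q - Polynomial.C a))) ⟶
      Spec (CommRingCat.of A) :=
  Spec.map (CommRingCat.ofHom (algebraMap A _))

/-- Since `X ^ q - a` is monic of degree `q > 0`, the extension is free of positive rank, hence
faithfully flat, and it is of finite presentation. -/
lemma rootCover_mem {A : Type u} [CommRing A] [Nontrivial A] (a : A) {q : ℕ} (hq : q ≠ 0) :
    Presieve.singleton (rootCover a q) ∈ Scheme.fppfPrecoverage (Spec (CommRingCat.of A)) := by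
  have hm := Polynomial.monic_X_pow_sub_C a hq
  have h1 : Module.Free A (AdjoinRoot (Polynomial.X ^ q - Polynomial.C a)) := hm.free_adjoinRoot
  -- The basis of powers of the root has `q ≥ 1` members, so it has one of index `0`, which is a
  -- nonzero element.
  have h2 : Nontrivial (AdjoinRoot (Polynomial.X ^ q - Polynomial.C a)) :=
    ⟨⟨_, _, (AdjoinRoot.powerBasisAux' hm).ne_zero
      ⟨0, by rw [Polynomial.natDegree_X_pow_sub_C]; omega⟩⟩⟩
  have h3 : Module.FaithfullyFlat A (AdjoinRoot (Polynomial.X ^ q - Polynomial.C a)) :=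
    inferInstance
  obtain ⟨_, _⟩ := (flat_and_surjective_SpecMap_iff (CommRingCat.ofHom (algebraMap A
    (AdjoinRoot (Polynomial.X ^ q - Polynomial.C a))))).mpr
      (RingHom.faithfullyFlat_algebraMap_iff.mpr h3)
  have : LocallyOfFinitePresentation (Spec.map (CommRingCat.ofHom (algebraMap A
      (AdjoinRoot (Polynomial.X ^ q - Polynomial.C a))))) := by
    rw [LocallyOfFinitePresentation.SpecMap_iff, CommRingCat.hom_ofHom,
      RingHom.finitePresentation_algebraMap]
    infer_instance
  exact Scheme.Hom.singleton_mem_fppfPrecoverage (Spec.map (CommRingCat.ofHom (algebraMap A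
    (AdjoinRoot (Polynomial.X ^ q - Polynomial.C a)))))

/-- The coordinate of the affine line. -/
abbrev affineCoordinate : MvPolynomial PUnit.{u + 1} (ULift.{u} ℤ) := MvPolynomial.X PUnit.unit

/-- The covering sieve of `T` that is defined by the extraction of a `q`-th root of a function. -/
def rootSieve (T : Scheme.{u}) (a : Γ(T, ⊤)) (q : ℕ) : Sieve T :=
  (Sieve.generate (Presieve.singleton (rootCover affineCoordinate q))).pullback
    ((gammaEquiv T).symm a)

/-- Every function is the pullback of the coordinate of the affine line, so only the universal case
has to be covered, and there the base ring is nontrivial. -/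
lemma rootSieve_mem (T : Scheme.{u}) (a : Γ(T, ⊤)) {q : ℕ} (hq : q ≠ 0) :
    rootSieve T a q ∈ Scheme.fppfTopology T :=
  GrothendieckTopology.pullback_stable _ _
    (Precoverage.generate_mem_toGrothendieck (rootCover_mem _ hq))

lemma gammaEquiv_specMap {B : CommRingCat.{u}}
    (f : CommRingCat.of (MvPolynomial PUnit.{u + 1} (ULift.{u} ℤ)) ⟶ B) :
    gammaEquiv (Spec B) (Spec.map f) = (Scheme.ΓSpecIso B).inv (f affineCoordinate) := by
  change ((Scheme.ΓSpecIso _).inv ≫ (Spec.map f).appTop) affineCoordinate = _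
  rw [← Scheme.ΓSpecIso_inv_naturality]
  rfl

lemma root_pow {A : Type u} [CommRing A] (a : A) (q : ℕ) :
    AdjoinRoot.root (Polynomial.X ^ q - Polynomial.C a) ^ q = algebraMap A _ a := by
  have := AdjoinRoot.eval₂_root (Polynomial.X ^ q - Polynomial.C a)
  simp only [Polynomial.eval₂_sub, Polynomial.eval₂_pow, Polynomial.eval₂_X,
    Polynomial.eval₂_C] at this
  exact sub_eq_zero.mp this

/-- Membership in the sieve means that the classifying map `Y → 𝔸¹` factors through the universal
root covering; the pullback of the adjoined root along this factorization is the required root. -/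
lemma exists_root_of_mem_rootSieve {T Y : Scheme.{u}} {a : Γ(T, ⊤)} {q : ℕ} {h : Y ⟶ T}
    (hh : rootSieve T a q h) : ∃ t : Γ(Y, ⊤), t ^ q = h.appTop a := by
  have h1 : gammaEquiv Y (h ≫ (gammaEquiv T).symm a) = h.appTop a := by
    refine (gammaRepresentableBy.homEquiv_comp h ((gammaEquiv T).symm a)).trans ?_
    exact congrArg h.appTop ((gammaEquiv T).apply_symm_apply a)
  obtain ⟨Z, l, r, ⟨⟩, hl⟩ := hh
  have h2 : gammaEquiv _ (l ≫ rootCover affineCoordinate q) =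
      l.appTop (gammaEquiv _ (rootCover affineCoordinate q)) :=
    gammaRepresentableBy.homEquiv_comp l (rootCover affineCoordinate q)
  have h3 : gammaEquiv _ (rootCover affineCoordinate q) =
      (Scheme.ΓSpecIso (CommRingCat.of (AdjoinRoot
        (Polynomial.X ^ q - Polynomial.C affineCoordinate)))).inv
          (AdjoinRoot.root (Polynomial.X ^ q - Polynomial.C affineCoordinate) ^ q) := by
    rw [root_pow]
    exact gammaEquiv_specMap _
  refine ⟨l.appTop ((Scheme.ΓSpecIso (CommRingCat.of (AdjoinRoot
    (Polynomial.X ^ q - Polynomial.C affineCoordinate)))).inv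
      (AdjoinRoot.root (Polynomial.X ^ q - Polynomial.C affineCoordinate))), ?_⟩
  rw [← h1, ← hl, h2, h3, map_pow, map_pow]

/-- In characteristic `p` the map `F^m` raises each of the `n` coordinates to the power `p ^ m`, so
a preimage exists on the intersection of the `n` sieves that extract the roots of the coordinates.
-/
instance epi_frobPow (n m : ℕ) : Epi (frobPow p k R n m) := by
  have : Sheaf.IsLocallySurjective (frobPow p k R n m) := ⟨fun {T} s => by
    rw [GrothendieckTopology.mem_over_iff]
    let S : Sieve T.left := Finset.univ.inf fun i : Fin n => rootSieve T.left
      (TruncatedWittVector.coeff (p := p) (R := Γ(T.left, ⊤)) i s.down) (p ^ m)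
    have hq : p ^ m ≠ 0 := pow_ne_zero _ (Fact.out : p.Prime).ne_zero
    have hS : S ∈ Scheme.fppfTopology T.left :=
      Finset.inf_induction (p := fun S => S ∈ Scheme.fppfTopology T.left)
        (GrothendieckTopology.top_mem _ _)
        (fun _ h _ h' => GrothendieckTopology.intersection_covering _ h h')
        (fun i _ => rootSieve_mem _ _ hq)
    refine GrothendieckTopology.superset_covering _ ?_ hS
    intro Y f hf
    refine (Sieve.overEquiv_iff (Y := T) _ _).mpr ?_
    choose t ht using fun i : Fin n => exists_root_of_mem_rootSieve
      ((Finset.inf_le (Finset.mem_univ i) : S ≤ _) _ hf)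
    refine ⟨ULift.up (TruncatedWittVector.mk p (R := Γ(Y, ⊤)) t), ULift.ext _ _ ?_⟩
    refine TruncatedWittVector.ext (p := p) fun i => ?_
    refine (wittAction_frob_pow p k (A := Functions R (Over.mk (f ≫ T.hom))) m _ i).trans ?_
    refine Eq.trans ?_ (coeff_map_functions p k (overCompHom T f) s.down i).symm
    refine Eq.trans ?_ (ht i)
    exact congrArg (· ^ p ^ m) (TruncatedWittVector.coeff_mk (p := p) (R := Γ(Y, ⊤)) t i)⟩
  exact (Sheaf.isLocallySurjective_iff_epi' _ _).mp this

lemma frobSequence_shortExact (n m : ℕ) : (frobSequence p k R n m).ShortExact where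
  mono_f := inferInstanceAs (Mono (lInclusion p k R n m))
  epi_g := inferInstanceAs (Epi (frobPow p k R n m))
  exact := by
    have : Mono (frobSequence p k R n m).f := mono_lInclusion p k R n m
    refine ShortComplex.exact_of_f_is_kernel _ ?_
    -- By definition `𝐋_{n,m}` is the sectionwise kernel, so a homomorphism killed by `F^m` takes
    -- values in it.
    refine KernelFork.IsLimit.ofι' _ _ fun {G} φ hφ => ⟨⟨
      { app := fun T => AddCommGrpCat.ofHom
          { toFun := fun x => ULift.up ⟨(φ.hom.app T x).down, by
              have := ConcreteCategory.congr_hom (congr_app (congrArg (fun f => f.hom) hφ) T) x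
              exact congrArg ULift.down this⟩
            map_zero' := by
              refine ULift.ext _ _ (Subtype.ext ?_)
              exact congrArg ULift.down (map_zero (φ.hom.app T).hom)
            map_add' := fun x y => by
              refine ULift.ext _ _ (Subtype.ext ?_)
              exact congrArg ULift.down (map_add (φ.hom.app T).hom x y) }
        naturality := fun T T' f => by
          ext x
          refine ULift.ext _ _ (Subtype.ext ?_)
          exact congrArg ULift.down (ConcreteCategory.congr_hom (φ.hom.naturality f) x) }⟩, ?_⟩
    apply Sheaf.hom_ext
    ext T x
    rfl

end Frobenius

/-! ### Comparison of Zariski and flat cohomology in degree one -/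

section ZarToFlat

open Abelian Opposite

lemma ext_comp_square {C : Type*} [Category* C] [Abelian C] [HasExt.{u} C] {P Y Z Z' W W' : C}
    {i : ℕ} (a : P ⟶ Y) (x : Ext.{u} Y Z i) (f : Z ⟶ Z') (e' : Z' ⟶ W') (e : Z ⟶ W) (g : W ⟶ W')
    (h : f ≫ e' = e ≫ g) :
    ((Ext.mk₀ a).comp (x.comp (Ext.mk₀ f) (add_zero i)) (zero_add i)).comp (Ext.mk₀ e')
        (add_zero i) =
      (((Ext.mk₀ a).comp x (zero_add i)).comp (Ext.mk₀ e) (add_zero i)).comp (Ext.mk₀ g)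
        (add_zero i) := by
  simp only [Ext.comp_assoc_of_third_deg_zero, Ext.mk₀_comp_mk₀, h]

lemma ext_comp_connecting {C : Type*} [Category* C] [Abelian C] [HasExt.{u} C]
    {P Q Y Z Y' Z' : C} {i : ℕ} (a : P ⟶ Q) (b : Q ⟶ Y) (x : Ext.{u} Y Z i) (e : Z ⟶ Z')
    (e' : Y ⟶ Y') (x' : Ext.{u} Y' Z' i)
    (h : x.comp (Ext.mk₀ e) (add_zero i) = (Ext.mk₀ e').comp x' (zero_add i)) :
    ((Ext.mk₀ a).comp ((Ext.mk₀ b).comp x (zero_add i)) (zero_add i)).comp (Ext.mk₀ e)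
        (add_zero i) =
      (Ext.mk₀ (a ≫ b ≫ e')).comp x' (zero_add i) := by
  simp only [Ext.comp_assoc_of_third_deg_zero, h, ← Ext.mk₀_comp_mk₀,
    Ext.comp_assoc_of_second_deg_zero]

lemma ext_comp_g_extClass {C : Type*} [Category* C] [Abelian C] [HasExt.{u} C]
    {S : ShortComplex C} (hS : S.ShortExact) {P : C} (f : P ⟶ S.X₂) :
    (Ext.mk₀ (f ≫ S.g)).comp hS.extClass (zero_add 1) = 0 := by
  rw [← Ext.mk₀_comp_mk₀, Ext.comp_assoc_of_second_deg_zero, hS.comp_extClass, Ext.comp_zero]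

instance wEqualsLocallyBijectiveZar (X : Scheme.{u}) :
    (zarTop X).WEqualsLocallyBijective AddCommGrpCat.{u + 1} := by
  have : EssentiallySmall.{u + 1} X.Opens := inferInstance
  exact GrothendieckTopology.WEqualsLocallyBijective.ofEssentiallySmall (zarTop X)

variable {X : Scheme.{u}}

/-- The homomorphism `ℤ_U → G` of fppf sheaves that corresponds to a homomorphism of Zariski
sheaves from `ℤ_U` to the restriction of `G`. -/
def zarToFlatHom (U : X.Opens) {G : Sheaf (flTop X) AddCommGrpCat.{u + 1}}
    (f : (freeSheaf (zarTop X)).obj U ⟶ (toZar X).obj G) :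
    (freeSheaf (flTop X)).obj (X.restrictFunctor.obj U) ⟶ G :=
  freeSheafToInverseImage X U ≫ (fromZar X).map f ≫ (zarAdj X).counit.app G

/-- On sections the comparison in degree zero is the identity of `G(U)`: unit and counit of the
adjunction cancel. Its bijectivity follows. -/
lemma homSection_zarToFlatHom (U : X.Opens) {G : Sheaf (flTop X) AddCommGrpCat.{u + 1}}
    (f : (freeSheaf (zarTop X)).obj U ⟶ (toZar X).obj G) :
    homSection (zarToFlatHom U f) = homSection f := by
  have h : (zarAdj X).unit.app _ ≫ (toZar X).map ((fromZar X).map f ≫ (zarAdj X).counit.app G) =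
      f := by
    have := ((zarAdj X).homEquiv _ _).apply_symm_apply f
    rwa [Adjunction.homEquiv_unit, Adjunction.homEquiv_counit] at this
  rw [zarToFlatHom, homSection_comp, freeSheafToInverseImage]
  refine (congrArg _ (homSection_freeSheafDesc _)).trans ?_
  exact ConcreteCategory.congr_hom (congr_app (congrArg (fun f => f.hom) h) (op U))
    (freeSheafSection (zarTop X) U)

lemma zarToFlatHom_injective (U : X.Opens) (G : Sheaf (flTop X) AddCommGrpCat.{u + 1}) :
    Function.Injective (zarToFlatHom U (G := G)) := fun f f' h => homSection_injective (by
  rw [← homSection_zarToFlatHom, ← homSection_zarToFlatHom, h])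

lemma zarToFlatHom_surjective (U : X.Opens) (G : Sheaf (flTop X) AddCommGrpCat.{u + 1}) :
    Function.Surjective (zarToFlatHom U (G := G)) := fun f =>
  ⟨freeSheafDesc (J := zarTop X) (T := U) (G := (toZar X).obj G)
      (homSection (J := flTop X) f), homSection_injective (by
    rw [homSection_zarToFlatHom]
    exact homSection_freeSheafDesc (J := zarTop X) (T := U) (G := (toZar X).obj G)
      (homSection (J := flTop X) f))⟩

lemma zarToFlatHom_comp (U : X.Opens) {G G' : Sheaf (flTop X) AddCommGrpCat.{u + 1}}
    (f : (freeSheaf (zarTop X)).obj U ⟶ (toZar X).obj G) (φ : G ⟶ G') :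
    zarToFlatHom U (f ≫ (toZar X).map φ) = zarToFlatHom U f ≫ φ := by
  simp only [zarToFlatHom, Functor.map_comp, Category.assoc]
  rw [Adjunction.counit_naturality]

lemma zarToFlat_add (U : X.Opens) (G : Sheaf (flTop X) AddCommGrpCat.{u + 1}) (i : ℕ)
    (x y : Ext.{u + 1} ((freeSheaf (zarTop X)).obj U) ((toZar X).obj G) i) :
    zarToFlat X U G i (x + y) = zarToFlat X U G i x + zarToFlat X U G i y := by
  simp only [zarToFlat, Ext.mapExactFunctor_add, Ext.comp_add, Ext.add_comp]

lemma zarToFlat_comp_mk₀ (U : X.Opens) {G G' : Sheaf (flTop X) AddCommGrpCat.{u + 1}} (φ : G ⟶ G')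
    (i : ℕ) (x : Ext.{u + 1} ((freeSheaf (zarTop X)).obj U) ((toZar X).obj G) i) :
    zarToFlat X U G' i (x.comp (Ext.mk₀ ((toZar X).map φ)) (add_zero i)) =
      (zarToFlat X U G i x).comp (Ext.mk₀ φ) (add_zero i) := by
  rw [zarToFlat, Ext.mapExactFunctor_comp, Ext.mapExactFunctor_mk₀]
  exact ext_comp_square _ _ _ _ _ _ ((zarAdj X).counit_naturality φ)

/-- The comparison commutes with connecting homomorphisms: the exact functor `fromZar` preserves
extension classes, and the counit is a morphism of short exact sequences, along which extension
classes are natural. -/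
lemma zarToFlat_mk₀_comp_extClass (U : X.Opens)
    {S : ShortComplex (Sheaf (flTop X) AddCommGrpCat.{u + 1})} (hS : S.ShortExact)
    (hRS : (S.map (toZar X)).ShortExact)
    (f : (freeSheaf (zarTop X)).obj U ⟶ (toZar X).obj S.X₃) :
    zarToFlat X U S.X₁ 1 ((Ext.mk₀ f).comp hRS.extClass (zero_add 1)) =
      (Ext.mk₀ (zarToFlatHom U f)).comp hS.extClass (zero_add 1) := by
  let ε : (S.map (toZar X)).map (fromZar X) ⟶ S :=
    { τ₁ := (zarAdj X).counit.app S.X₁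
      τ₂ := (zarAdj X).counit.app S.X₂
      τ₃ := (zarAdj X).counit.app S.X₃
      comm₁₂ := ((zarAdj X).counit_naturality S.f).symm
      comm₂₃ := ((zarAdj X).counit_naturality S.g).symm }
  have h := ShortComplex.ShortExact.extClass_naturality (hRS.map_of_exact (fromZar X)) hS ε
  let f' : (freeSheaf (zarTop X)).obj U ⟶ (S.map (toZar X)).X₃ := f
  have key := Ext.mapExactFunctor_comp (fromZar X) (Ext.mk₀ f') hRS.extClass (zero_add 1)
  rw [Ext.mapExactFunctor_mk₀, Ext.mapExactFunctor_extClass] at key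
  refine (congrArg (fun t => ((Ext.mk₀ (freeSheafToInverseImage X U)).comp t (zero_add 1)).comp
    (Ext.mk₀ ((zarAdj X).counit.app S.X₁)) (add_zero 1)) key).trans ?_
  exact ext_comp_connecting _ _ _ _ _ _ h

/-- Restriction is left exact as a right adjoint. Local surjectivity may be tested on affine open
subsets, where sections lift by `surjective_sections_of_isAffine`. -/
lemma shortExact_map_toZar {S : ShortComplex (Sheaf (flTop X) AddCommGrpCat.{u + 1})}
    (hS : S.ShortExact) (hG : CechAcyclic S.X₁) : (S.map (toZar X)).ShortExact := by
  have := hS.mono_f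
  have hlim : PreservesLimits (toZar X) := (zarAdj X).rightAdjoint_preservesLimits
  refine
    { exact := hS.exact.map_of_mono_of_preservesKernel (toZar X) inferInstance inferInstance
      mono_f := inferInstanceAs (Mono ((toZar X).map S.f))
      epi_g := ?_ }
  have : Sheaf.IsLocallySurjective ((toZar X).map S.g) := ⟨fun {U} q => by
    intro x hx
    obtain ⟨V, hV, hxV, hVU⟩ := TopologicalSpace.Opens.isBasis_iff_nbhd.mp X.isBasis_affineOpens hx
    have : IsAffine (X.restrictFunctor.obj V).left := hV
    obtain ⟨s, hs⟩ := surjective_sections_of_isAffine hS hG (X.restrictFunctor.obj V)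
      (S.X₃.obj.map (X.restrictFunctor.map (homOfLE hVU)).op q)
    exact ⟨V, homOfLE hVU, ⟨s, hs⟩, hxV⟩⟩
  exact (Sheaf.isLocallySurjective_iff_epi' _ _).mp this

/-- An exact sequence `0 → G → I → Q → 0` with `I` injective. -/
def injectiveSequence {C : Type*} [Category* C] [Abelian C] [EnoughInjectives C] (G : C) :
    ShortComplex C :=
  ShortComplex.mk (Injective.ι G) (cokernel.π (Injective.ι G)) (cokernel.condition _)

lemma injectiveSequence_shortExact {C : Type*} [Category* C] [Abelian C] [EnoughInjectives C]
    (G : C) : (injectiveSequence G).ShortExact where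
  exact := ShortComplex.exact_cokernel _
  mono_f := inferInstanceAs (Mono (Injective.ι G))
  epi_g := inferInstanceAs (Epi (cokernel.π (Injective.ι G)))

/-- Embed `G` into an injective `I` with quotient `Q`. The sequence stays exact on the Zariski site,
and the restriction of `I` stays injective because `toZar` has an exact left adjoint. So both groups
`H¹` are the cokernel of `I(U) → Q(U)`. -/
lemma zarToFlat_bijective (U : X.Opens) (G : Sheaf (flTop X) AddCommGrpCat.{u + 1})
    (hG : CechAcyclic G) : Function.Bijective (zarToFlat X U G 1) := by
  let S := injectiveSequence G
  have hS : S.ShortExact := injectiveSequence_shortExact G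
  have hRS : (S.map (toZar X)).ShortExact := shortExact_map_toZar hS hG
  have hI : Injective S.X₂ := inferInstanceAs (Injective (Injective.under G))
  have hRI : Injective (S.map (toZar X)).X₂ := Injective.injective_of_adjoint (zarAdj X) S.X₂
  have hz (x : Ext.{u + 1} ((freeSheaf (zarTop X)).obj U) ((toZar X).obj G) 1) :
      ∃ f : (freeSheaf (zarTop X)).obj U ⟶ (toZar X).obj S.X₃,
        x = (Ext.mk₀ f).comp hRS.extClass (zero_add 1) := by
    obtain ⟨y, hy⟩ := Ext.covariant_sequence_exact₁ _ hRS x (Ext.eq_zero_of_injective _)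
      (zero_add 1)
    obtain ⟨f, rfl⟩ := (Ext.mk₀_bijective _ _).2 y
    exact ⟨f, hy.symm⟩
  constructor
  · let c : Ext.{u + 1} ((freeSheaf (zarTop X)).obj U) ((toZar X).obj G) 1 →+
        Ext.{u + 1} ((freeSheaf (flTop X)).obj (X.restrictFunctor.obj U)) G 1 :=
      AddMonoidHom.mk' (zarToFlat X U G 1) (zarToFlat_add U G 1)
    refine (injective_iff_map_eq_zero c).mpr fun x hx => ?_
    obtain ⟨f, rfl⟩ := hz x
    have hx' := (zarToFlat_mk₀_comp_extClass U hS hRS f).symm.trans hx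
    -- If the flat class vanishes, the section of `Q` over `U` lifts to `I`. Such a lift is at the
    -- same time a lift on the Zariski site, so the Zariski class vanishes.
    obtain ⟨y, hy⟩ := Ext.covariant_sequence_exact₃ _ hS _ (zero_add 1) hx'
    obtain ⟨j, rfl⟩ := (Ext.mk₀_bijective _ _).2 y
    obtain ⟨j, rfl⟩ := zarToFlatHom_surjective U _ j
    rw [Ext.mk₀_comp_mk₀] at hy
    have hy' := (Ext.mk₀_bijective _ _).1 hy
    rw [← zarToFlatHom_comp] at hy'
    have hf := zarToFlatHom_injective U _ hy'
    rw [← hf]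
    exact ext_comp_g_extClass hRS j
  · intro y
    obtain ⟨z, hz⟩ := Ext.covariant_sequence_exact₁ _ hS y (Ext.eq_zero_of_injective _)
      (zero_add 1)
    obtain ⟨f, rfl⟩ := (Ext.mk₀_bijective _ _).2 z
    obtain ⟨f, rfl⟩ := zarToFlatHom_surjective U _ f
    exact ⟨_, (zarToFlat_mk₀_comp_extClass U hS hRS f).trans hz⟩

end ZarToFlat

/-! ### Local torsors and local cohomology -/

section LocalCohomology

open Abelian Opposite

lemma ext_comp_comm {C : Type*} [Category* C] [Abelian C] [HasExt.{u} C] {P Y Z Z' W : C} {i : ℕ}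
    (x : Ext.{u} P Y i) {f : Y ⟶ Z} {g : Z ⟶ W} {f' : Y ⟶ Z'} {g' : Z' ⟶ W}
    (h : f ≫ g = f' ≫ g') :
    (x.comp (Ext.mk₀ f) (add_zero i)).comp (Ext.mk₀ g) (add_zero i) =
      (x.comp (Ext.mk₀ f') (add_zero i)).comp (Ext.mk₀ g') (add_zero i) := by
  simp only [Ext.comp_assoc_of_third_deg_zero, Ext.mk₀_comp_mk₀, h]

lemma ext_comp_comp_eq_zero {C : Type*} [Category* C] [Abelian C] [HasExt.{u} C] {P Y Z W : C}
    {i : ℕ} (x : Ext.{u} P Y i) {f : Y ⟶ Z} {g : Z ⟶ W} (h : f ≫ g = 0) :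
    (x.comp (Ext.mk₀ f) (add_zero i)).comp (Ext.mk₀ g) (add_zero i) = 0 := by
  rw [Ext.comp_assoc_of_third_deg_zero, Ext.mk₀_comp_mk₀, h, Ext.mk₀_zero, Ext.comp_zero]

lemma frobKer_map (p : ℕ) [Fact p.Prime] (k : Type u) [Field k] [CharP k p]
    {M N : Type*} [AddCommGroup M] [Module (DieudonneRing p k) M] [AddCommGroup N]
    [Module (DieudonneRing p k) N] (e : M ≃ₗ[DieudonneRing p k] N) (m : ℕ) :
    (frobKer (p := p) (k := k) m M).map (e : M →ₗ[DieudonneRing p k] N) =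
      frobKer (p := p) (k := k) m N := by
  ext y
  obtain ⟨x, rfl⟩ := e.surjective y
  have h : (x ∈ frobKer (p := p) (k := k) m M) ↔ e x ∈ frobKer (p := p) (k := k) m N := by
    change _ • x = 0 ↔ _ • e x = 0
    rw [← map_smul, e.map_eq_zero_iff]
  rw [← h]
  exact ⟨fun ⟨x', hx', hxx⟩ => e.injective hxx ▸ hx', fun hx => ⟨x, hx, rfl⟩⟩

/-- A class in `H¹` is the connecting image of a section of the quotient of an injective sheaf by
`G`, and over an affine scheme this section lifts. -/
lemma ext_eq_zero_of_isAffine {X : Scheme.{u}} {G : Sheaf (flTop X) AddCommGrpCat.{u + 1}}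
    (hG : CechAcyclic G) (T : Over X) [IsAffine T.left]
    (x : Ext.{u + 1} ((freeSheaf (flTop X)).obj T) G 1) : x = 0 := by
  let S := injectiveSequence G
  have hS : S.ShortExact := injectiveSequence_shortExact G
  have hI : Injective S.X₂ := inferInstanceAs (Injective (Injective.under G))
  obtain ⟨y, rfl⟩ := Ext.covariant_sequence_exact₁ _ hS x (Ext.eq_zero_of_injective _)
    (zero_add 1)
  obtain ⟨f, rfl⟩ := (Ext.mk₀_bijective _ _).2 y
  obtain ⟨f, rfl⟩ := exists_homSection_lift S.g T (surjective_sections_of_isAffine hS hG T) f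
  exact ext_comp_g_extClass hS f

lemma eq_top_of_closedPoint_mem {R : Type u} [CommRing R] [IsLocalRing R] {V : (specX R).Opens}
    (h : IsLocalRing.closedPoint R ∈ V) : V = ⊤ :=
  top_le_iff.mp fun x _ => (IsLocalRing.specializes_closedPoint x).mem_open V.isOpen h

/-- The only neighbourhood of the closed point is the whole spectrum, so a section that lifts
locally there lifts globally. Thus global sections are exact and all higher Zariski cohomology of
`X` vanishes. -/
instance projective_freeSheaf_top (R : Type u) [CommRing R] [IsLocalRing R] :
    Projective ((freeSheaf (zarTop (specX R))).obj ⊤) where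
  factors {E Y} f e he := by
    have := (Sheaf.isLocallySurjective_iff_epi' _ e).mpr he
    refine exists_homSection_lift e ⊤ (fun s => ?_) f
    obtain ⟨V, i, ⟨t, ht⟩, hV⟩ := Presheaf.imageSieve_mem (zarTop (specX R)) e.hom s
      (IsLocalRing.closedPoint R) trivial
    obtain rfl := eq_top_of_closedPoint_mem hV
    obtain rfl := Subsingleton.elim i (𝟙 _)
    exact ⟨t, ht.trans (by simp)⟩

variable (p : ℕ) [Fact p.Prime] (k : Type u) [Field k] [CharP k p] [PerfectRing k p]
variable (R : Type u) [CommRing R] [Algebra k R]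

/-- In the long exact sequence of `0 → ℤ_U → ℤ_X → ℤ_X/ℤ_U → 0` the neighbouring terms `Ext¹` and
`Ext²` of `ℤ_X` vanish by projectivity. -/
lemma localConnecting_bijective [IsLocalRing R] (n : ℕ) :
    Function.Bijective (localConnecting p k R n) := by
  have hS := supportSequence_shortExact (puncturedSpec R)
  have hP : Projective (supportSequence (puncturedSpec R)).X₂ := projective_freeSheaf_top R
  constructor
  · refine (injective_iff_map_eq_zero _).mpr fun z hz => ?_
    obtain ⟨y, rfl⟩ := Ext.contravariant_sequence_exact₁ hS _ z (add_comm 1 1) hz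
    rw [Ext.eq_zero_of_projective y]
    exact map_zero (DExt.precomp (supportSequence (puncturedSpec R)).f (wittSheafZar p k R n) 1)
  · intro z
    exact Ext.contravariant_sequence_exact₃ hS _ z (Ext.eq_zero_of_projective _) (add_comm 1 1)

variable {R}

/-- The `𝔻`-linear comparison `H¹(U, W_n 𝒪_U) ≃ H¹_fl(U, 𝐖_n)`. -/
def wittComparison (U : (specX R).Opens) (n : ℕ) :
    zarH1 p k U n ≃ₗ[DieudonneRing p k]
      DExt ((freeSheaf (flTop (specX R))).obj ((specX R).restrictFunctor.obj U))
        (wittSheaf p k R n) 1 :=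
  LinearEquiv.ofBijective
    ({  toFun := wittZarToFlat p k U n
        map_add' := zarToFlat_add U (wittSheaf p k R n).sheaf 1
        map_smul' := fun d z => zarToFlat_comp_mk₀ U ((wittSheaf p k R n).action d) 1 z } :
      zarH1 p k U n →ₗ[DieudonneRing p k]
        DExt ((freeSheaf (flTop (specX R))).obj ((specX R).restrictFunctor.obj U))
          (wittSheaf p k R n) 1)
    (zarToFlat_bijective U _ (cechAcyclic_wittSheaf p k R n))

lemma lInclusion_action (n m : ℕ) (d : DieudonneRing p k) :
    (lSheaf p k R n m).action d ≫ lInclusion p k R n m =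
      lInclusion p k R n m ≫ (wittSheaf p k R n).action d := by
  apply Sheaf.hom_ext
  ext T x
  rfl

/-- The `𝔻`-linear map `H¹_fl(U, 𝐋_{n,m}) → H¹_fl(U, 𝐖_n)`. -/
def flatInclusionLinear (U : (specX R).Opens) (n m : ℕ) :
    flatH1 p k U n m →ₗ[DieudonneRing p k]
      DExt ((freeSheaf (flTop (specX R))).obj ((specX R).restrictFunctor.obj U))
        (wittSheaf p k R n) 1 where
  toFun := flatInclusion p k U n m
  map_add' _ _ := Ext.add_comp _ _ _ _
  map_smul' d ξ := ext_comp_comm ξ (lInclusion_action p k n m d)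

/-- This is exactness at `H¹_fl(U, 𝐖_n)` of the long exact sequence of `frobSequence`, in which the
outgoing map is the action of `F^m` on cohomology. -/
lemma range_flatInclusionLinear (U : (specX R).Opens) (n m : ℕ) :
    LinearMap.range (flatInclusionLinear p k U n m) = frobKer (p := p) (k := k) m _ := by
  have hS := frobSequence_shortExact p k R n m
  ext y
  constructor
  · rintro ⟨ξ, rfl⟩
    exact ext_comp_comp_eq_zero ξ (frobSequence p k R n m).zero
  · intro hy
    exact Ext.covariant_sequence_exact₂ _ hS y hy

/-- A class that dies in `H¹_fl(U, 𝐖_n)` is the connecting image of a Witt vector over `U`, which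
extends to `X`. Conversely, a class from `X` dies already in `H¹_fl(X, 𝐖_n) = 0`. -/
lemma ker_flatInclusionLinear [IsLocalRing R] (hR : IsSingularity R) (n m : ℕ) :
    LinearMap.ker (flatInclusionLinear p k (puncturedSpec R) n m) =
      LinearMap.range (flatRestriction p k (puncturedSpec R) n m) := by
  have hS := frobSequence_shortExact p k R n m
  ext ξ
  constructor
  · intro hξ
    obtain ⟨y, hy⟩ := Ext.covariant_sequence_exact₁ _ hS ξ hξ (zero_add 1)
    obtain ⟨f, rfl⟩ := (Ext.mk₀_bijective _ _).2 y
    -- A Witt vector is extended by extending each coordinate as a function.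
    choose t ht using fun i : Fin n => surjective_functions_map_openInclusion k R hR
      (TruncatedWittVector.coeff (p := p) i (homSection f).down)
    let s : (frobSequence p k R n m).X₃.obj.obj (op (Over.mk (𝟙 (specX R)))) :=
      ULift.up (TruncatedWittVector.mk p
        (R := Functions R (Over.mk (𝟙 (specX R)))) t)
    have hs : (freeSheaf (flTop (specX R))).map (openInclusion (puncturedSpec R)) ≫
        freeSheafDesc s = f := by
      apply homSection_injective
      rw [homSection_map_comp, homSection_freeSheafDesc]
      refine ULift.ext _ _ (TruncatedWittVector.ext (p := p) fun i => ?_)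
      refine (coeff_map_functions p k (openInclusion (puncturedSpec R)) s.down i).trans ?_
      refine Eq.trans ?_ (ht i)
      exact congrArg _ (TruncatedWittVector.coeff_mk (p := p)
        (R := Functions R (Over.mk (𝟙 (specX R)))) t i)
    -- The torsor over `X` is the connecting image of the extended Witt vector; associativity of
    -- composition shows that it restricts to `ξ`.
    refine ⟨(Ext.mk₀ (freeSheafDesc s)).comp hS.extClass (zero_add 1), ?_⟩
    refine Eq.trans ?_ hy
    rw [← hs, ← Ext.mk₀_comp_mk₀, Ext.comp_assoc_of_second_deg_zero]
    rfl
  · rintro ⟨ξ, rfl⟩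
    have : IsAffine (Over.mk (𝟙 (specX R))).left := inferInstanceAs (IsAffine (specX R))
    have h0 := ext_eq_zero_of_isAffine (cechAcyclic_wittSheaf p k R n) (Over.mk (𝟙 (specX R)))
      (Ext.comp (show Ext.{u + 1} _ (lSheaf p k R n m).sheaf 1 from ξ)
        (Ext.mk₀ (lInclusion p k R n m)) (add_zero 1))
    refine (Ext.comp_assoc_of_third_deg_zero (Ext.mk₀ ((freeSheaf (flTop (specX R))).map
      (openInclusion (puncturedSpec R)))) (show Ext.{u + 1} _ (lSheaf p k R n m).sheaf 1 from ξ)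
      (Ext.mk₀ (lInclusion p k R n m)) (zero_add 1)).trans ?_
    rw [h0]
    exact map_zero (DExt.precomp ((freeSheaf (flTop (specX R))).map
      (openInclusion (puncturedSpec R))) (wittSheaf p k R n) 1)

variable (R) in
/-- The isomorphism `H¹_fl(U, 𝐖_n) ≃ H²_𝔪(X, W_n 𝒪_X)`. -/
def flatToLocal [IsLocalRing R] (n : ℕ) :
    DExt ((freeSheaf (flTop (specX R))).obj ((specX R).restrictFunctor.obj (puncturedSpec R)))
      (wittSheaf p k R n) 1 ≃ₗ[DieudonneRing p k] localH2 p k R n :=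
  (wittComparison p k (puncturedSpec R) n).symm.trans
    (LinearEquiv.ofBijective (localConnecting p k R n) (localConnecting_bijective p k R n))

/-- The map `H¹_fl(U, 𝐋_{n,m}) → H²_𝔪(X, W_n 𝒪_X)` that passes through `H¹_fl(U, 𝐖_n)`. -/
abbrev torsorToLocal [IsLocalRing R] (n m : ℕ) :
    flatH1 p k (puncturedSpec R) n m →ₗ[DieudonneRing p k] localH2 p k R n :=
  (flatToLocal p k R n : _ →ₗ[DieudonneRing p k] _) ∘ₗ flatInclusionLinear p k (puncturedSpec R) n m

/-- The isomorphism between classes of local `𝐋_{n,m}`-torsors and `H²_𝔪(X, W_n 𝒪_X)[F^m]`. -/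
def torsorEquiv [IsLocalRing R] (hR : IsSingularity R) (n m : ℕ) :
    LocalTorsorClasses p k R n m ≃ₗ[DieudonneRing p k]
      frobKer (p := p) (k := k) m (localH2 p k R n) :=
  (Submodule.quotEquivOfEq _ _ (by
    rw [torsorToLocal, LinearMap.ker_comp_of_ker_eq_bot _ (LinearEquiv.ker _),
      ker_flatInclusionLinear p k hR])).trans
    ((torsorToLocal p k n m).quotKerEquivRange.trans (LinearEquiv.ofEq _ _ (by
      rw [torsorToLocal, LinearMap.range_comp, range_flatInclusionLinear, frobKer_map])))

lemma torsorEquiv_mk [IsLocalRing R] (hR : IsSingularity R) (n m : ℕ)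
    (ξ : flatH1 p k (puncturedSpec R) n m) :
    (torsorEquiv p k hR n m (Submodule.Quotient.mk ξ) : localH2 p k R n) =
      localConnecting p k R n ((wittComparison p k (puncturedSpec R) n).symm
        (flatInclusion p k (puncturedSpec R) n m ξ)) := rfl

end LocalCohomology

end LocalTorsor

end

theorem mainTheorem8 (p : ℕ) [Fact p.Prime] (k : Type u) [Field k] [CharP k p] [IsAlgClosed k]
    (R : Type u) [CommRing R] [IsLocalRing R] [Algebra k R] (hR : IsSingularity R) (n m : ℕ) :
    ∃! e : LocalTorsorClasses p k R n m ≃ₗ[DieudonneRing p k]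
        frobKer (p := p) (k := k) m (localH2 p k R n),
      ∀ ξ : flatH1 p k (puncturedSpec R) n m, ∃ z : zarH1 p k (puncturedSpec R) n,
        wittZarToFlat p k (puncturedSpec R) n z = flatInclusion p k (puncturedSpec R) n m ξ ∧
          (e (Submodule.Quotient.mk ξ) : localH2 p k R n) = localConnecting p k R n z := by
  have hc (ξ : flatH1 p k (puncturedSpec R) n m) :
      wittZarToFlat p k (puncturedSpec R) n ((wittComparison p k (puncturedSpec R) n).symm
        (flatInclusion p k (puncturedSpec R) n m ξ)) =
      flatInclusion p k (puncturedSpec R) n m ξ :=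
    (wittComparison p k (puncturedSpec R) n).apply_symm_apply _
  refine ⟨torsorEquiv p k hR n m, fun ξ => ⟨_, hc ξ, torsorEquiv_mk p k hR n m ξ⟩, fun e he => ?_⟩
  ext x
  obtain ⟨ξ, rfl⟩ := Submodule.Quotient.mk_surjective _ x
  obtain ⟨z, hz, hez⟩ := he ξ
  rw [hez, torsorEquiv_mk]
  -- The class `z` supplied for the competitor `e` has the same flat image as the one used for
  -- `torsorEquiv`, so the two coincide and `e` has no freedom left.
  exact congrArg _ ((wittComparison p k (puncturedSpec R) n).injective (hz.trans (hc ξ).symm))
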